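/- Let $\gamma>0$, $y_2\ge 0$ and $I=[-1,1]$, and consider the external field $$Q(x)=\gamma\log\frac{1}{\sqrt{x^2+y_2^2}},\qquad x\in I,$$ with $Q(0)=+\infty$ if $y_2=0$, created by a charge $\gamma$ placed at the point $(0,y_2)$ of the plane. Among all Borel probability measures $\mu$ on $I$, the weighted logarithmic energy $$I_Q(\mu)=\iint\log\frac{1}{|x-t|}\,d\mu(x)\,d\mu(t)+2\int Q\,d\mu\in(-\infty,+\infty]$$ has a unique minimizer $\omega_{Q,I}$ (the equilibrium measure). Put $\gamma_+=y_2\left(\sqrt{y_2^2+1}+y_2\right)$. 1) If $\gamma\le\gamma_+$, then $\omega_{Q,I}$ has support $[-1,1]$ and is absolutely continuous with respect to Lebesgue measure, with density $$\omega_{Q,I}'(x)=\left(1+\gamma-\frac{\gamma y_2\sqrt{y_2^2+1}}{x^2+y_2^2}\right)\frac{1}{\pi\sqrt{1-x^2}},\qquad -1<x<1.$$ 2) If $\gamma>\gamma_+$, then $\omega_{Q,I}$ has support $[-1,-\tilde r]\cup[\tilde r,1]$, where $$\tilde r=\frac{\sqrt{\gamma^2-(2\gamma+1)y_2^2}}{1+\gamma}\in(0,1),$$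 and is absolutely continuous with respect to Lebesgue measure, with density $$\omega_{Q,I}'(x)=\frac{1+\gamma}{\pi}\,\frac{|x|\sqrt{x^2-\tilde r^2}}{(x^2+y_2^2)\sqrt{1-x^2}},\qquad \tilde r<|x|<1.$$ -/

import Mathlib

open MeasureTheory Set

noncomputable section

namespace LogEquilibrium

/-- The integral `∫ f dμ = ∫ f⁺ dμ - ∫ f⁻ dμ` of an extended real function, with values in
`[-∞, ∞]`. It is only applied to functions that are `μ`-essentially bounded below, with `μ` finite,
so that `∫ f⁻ dμ` is finite. -/
def extIntegral {α : Type*} [MeasurableSpace α] (μ : Measure α) (f : α → EReal) : EReal :=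
  ((∫⁻ x, (f x).toENNReal ∂μ : ENNReal) : EReal) - ((∫⁻ x, (-f x).toENNReal ∂μ : ENNReal) : EReal)

/-- `log (1 / ρ)` for a distance `ρ ≥ 0`, equal to `+∞` at `ρ = 0`. -/
def logInv (ρ : ℝ) : EReal := -ENNReal.log (ENNReal.ofReal ρ)

/-- The logarithmic energy `I(μ) = ∬ log (1 / |x - t|) dμ(x) dμ(t)`. -/
def logEnergy (μ : Measure ℝ) : EReal :=
  extIntegral (μ.prod μ) (fun p : ℝ × ℝ => logInv |p.1 - p.2|)

/-- The weighted logarithmic energy `I_Q(μ) = I(μ) + 2 ∫ Q dμ`. -/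
def weightedEnergy (Q : ℝ → EReal) (μ : Measure ℝ) : EReal :=
  logEnergy μ + 2 * extIntegral μ Q

/-- `ω` is a weighted equilibrium measure of `K` in the external field `Q`: a probability measure
carried by `K` that minimizes `I_Q` among all probability measures carried by `K`. -/
structure IsEquilibriumMeasure (K : Set ℝ) (Q : ℝ → EReal) (ω : Measure ℝ) : Prop where
  isProbabilityMeasure : IsProbabilityMeasure ω
  carried : ω Kᶜ = 0
  minimal : ∀ μ : Measure ℝ, IsProbabilityMeasure μ → μ Kᶜ = 0 →
    weightedEnergy Q ω ≤ weightedEnergy Q μ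

/-- The external field `Q(x) = γ log (1 / |x - y|)` created on the real axis by a charge `γ` at the
point `y = (0, y₂)` of the plane. -/
def chargeField (γ y₂ : ℝ) (x : ℝ) : EReal := (γ : EReal) * logInv (Real.sqrt (x ^ 2 + y₂ ^ 2))

/-- The critical charge `γ₊`. -/
def gammaPlus (y₂ : ℝ) : ℝ := y₂ * (Real.sqrt (y₂ ^ 2 + 1) + y₂)

/-- The density on `(-1, 1)` in the subcritical case. -/
def fullDensity (γ y₂ x : ℝ) : ℝ :=
  (1 + γ - γ * y₂ * Real.sqrt (y₂ ^ 2 + 1) / (x ^ 2 + y₂ ^ 2)) *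
    (1 / (Real.pi * Real.sqrt (1 - x ^ 2)))

/-- The inner endpoint of the support in the supercritical case. -/
def innerRadius (γ y₂ : ℝ) : ℝ :=
  Real.sqrt (γ ^ 2 - (2 * γ + 1) * y₂ ^ 2) / (1 + γ)

/-- The density on `innerRadius γ y₂ < |x| < 1` in the supercritical case. -/
def gapDensity (γ y₂ x : ℝ) : ℝ :=
  (1 + γ) / Real.pi *
    (|x| * Real.sqrt (x ^ 2 - innerRadius γ y₂ ^ 2) /
      ((x ^ 2 + y₂ ^ 2) * Real.sqrt (1 - x ^ 2)))

end LogEquilibrium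

end

/-!
The equilibrium measure is identified by Frostman's conditions. Write `k(x, t) = -log |x - t|`.

*Positive definiteness.* On `[-1, 1]` the kernel has the formal Chebyshev expansion
`k(x, t) = log 2 + ∑ (2 / n) T_n(x) T_n(t)`. Damping the `n`-th term by `r ^ n` gives a kernel in
closed form (`abelKernel`), dominated by `|k|` up to a constant and converging to `k` off the
diagonal. Letting `r → 1` shows that the energy of a difference of two probability measures
dominates the square of the difference of each Chebyshev moment (`sq_chebMoment_sub_le`). Since
these moments determine the measure (`eq_of_chebMoment_eq`), a measure of finite energy whose total
potential is constant on its support, and not smaller elsewhere on `[-1, 1]`, is the unique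
minimizer.

*The potential of the explicit measure.* Both densities are the case `r = 0` or `r = innerRadius`
of one formula (`shellDensity`). Since the measure is even, `u = x²` turns its potential into half
that of its image on `[r², 1]`, which is `1 + γ` times the arcsine distribution minus `γ` times the
balayage of the unit mass at `-y²`. In the angle `φ` of `u = (1 + r²) / 2 + (1 - r²) / 2 * cos φ`
the balayage is the Poisson kernel of the unit disc at a real point `-q` (`angleDensity`). Its
logarithmic potential is therefore given by Poisson's formula for `log |1 - 2 r w z + r² z²|`, a
harmonic function on the closed disc (`integral_angleDensity_mul_abelKernel`): directly for points
off the support, and in the limit `r → 1` on the support. This yields the equality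
`IsEquilibriumRadius.potential_eq`; inside a gap the inequality `IsEquilibriumRadius.le_potential`
reduces to the monotonicity of a function of one variable (`green_excess_nonneg`), which has a
critical point at the edge exactly because the density vanishes there.
-/

/-! ### The regularized logarithmic kernel -/

namespace LogEquilibrium
open Filter Topology Polynomial

/-- The logarithmic kernel `log (1 / |x - t|)` as a real number, with the value `0` on the
diagonal. -/
noncomputable def logKernel (x t : ℝ) : ℝ := -Real.log |x - t|

/-- For `x = cos θ` and `t = cos φ` this is `|1 - r e^{i(θ - φ)}|² |1 - r e^{i(θ + φ)}|²`. -/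
def abelPoly (r x t : ℝ) : ℝ :=
  (1 - r ^ 2) ^ 2 + 4 * r ^ 2 * (x - t) ^ 2 - 4 * r * (1 - r) ^ 2 * x * t

/-- The Abel regularization of the logarithmic kernel on `[-1, 1]`: the Chebyshev coefficient of
order `n` is damped by `r ^ n`. -/
noncomputable def abelKernel (r x t : ℝ) : ℝ := Real.log 2 - Real.log (abelPoly r x t) / 2

lemma abelPoly_cos_cos (r θ φ : ℝ) :
    abelPoly r (Real.cos θ) (Real.cos φ) =
      (1 + r ^ 2 - 2 * r * Real.cos (θ - φ)) * (1 + r ^ 2 - 2 * r * Real.cos (θ + φ)) := by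
  rw [Real.cos_sub, Real.cos_add, abelPoly]
  have h1 := Real.sin_sq_add_cos_sq θ
  have h2 := Real.sin_sq_add_cos_sq φ
  have h3 : Real.sin θ ^ 2 = 1 - Real.cos θ ^ 2 := by linarith
  have h4 : Real.sin φ ^ 2 = 1 - Real.cos φ ^ 2 := by linarith
  linear_combination (4 * r ^ 2 * Real.sin φ ^ 2) * h3 + 4 * r ^ 2 * (1 - Real.cos θ ^ 2) * h4

lemma exists_cos_eq {x : ℝ} (hx : x ∈ Icc (-1 : ℝ) 1) : ∃ θ, Real.cos θ = x :=
  ⟨Real.arccos x, Real.cos_arccos hx.1 hx.2⟩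

lemma one_add_sq_sub_pos {r : ℝ} (hr0 : 0 ≤ r) (hr1 : r < 1) (α : ℝ) :
    0 < 1 + r ^ 2 - 2 * r * Real.cos α := by
  nlinarith [Real.cos_le_one α, sq_pos_of_pos (sub_pos.2 hr1)]

lemma abelPoly_pos {r x t : ℝ} (hr0 : 0 ≤ r) (hr1 : r < 1) (hx : x ∈ Icc (-1 : ℝ) 1)
    (ht : t ∈ Icc (-1 : ℝ) 1) : 0 < abelPoly r x t := by
  obtain ⟨θ, rfl⟩ := exists_cos_eq hx
  obtain ⟨φ, rfl⟩ := exists_cos_eq ht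
  rw [abelPoly_cos_cos]
  exact mul_pos (one_add_sq_sub_pos hr0 hr1 _) (one_add_sq_sub_pos hr0 hr1 _)

lemma abelPoly_le {r x t : ℝ} (hr0 : 0 ≤ r) (hr1 : r < 1) (hx : x ∈ Icc (-1 : ℝ) 1)
    (ht : t ∈ Icc (-1 : ℝ) 1) : abelPoly r x t ≤ 4 ^ 2 := by
  obtain ⟨θ, rfl⟩ := exists_cos_eq hx
  obtain ⟨φ, rfl⟩ := exists_cos_eq ht
  have key : ∀ α, 1 + r ^ 2 - 2 * r * Real.cos α ≤ 4 := fun α => by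
    nlinarith [Real.neg_one_le_cos α]
  rw [abelPoly_cos_cos, sq (4 : ℝ)]
  exact mul_le_mul (key _) (key _) (one_add_sq_sub_pos hr0 hr1 _).le (by norm_num)

/-- The product of the two elementary bounds
`|1 - r e^{iα}|² ≥ ((1 + r) / 2)² |1 - e^{iα}|²`. -/
lemma le_abelPoly {r x t : ℝ} (hr0 : 0 ≤ r) (hx : x ∈ Icc (-1 : ℝ) 1)
    (ht : t ∈ Icc (-1 : ℝ) 1) : ((1 + r) ^ 2 * |x - t| / 2) ^ 2 ≤ abelPoly r x t := by
  obtain ⟨θ, rfl⟩ := exists_cos_eq hx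
  obtain ⟨φ, rfl⟩ := exists_cos_eq ht
  have key : ∀ α, (1 + r) ^ 2 / 4 * (1 + 1 ^ 2 - 2 * 1 * Real.cos α)
      ≤ 1 + r ^ 2 - 2 * r * Real.cos α := fun α => by
    nlinarith [Real.neg_one_le_cos α, mul_nonneg (sq_nonneg (1 - r))
      (by linarith [Real.neg_one_le_cos α] : 0 ≤ 1 + Real.cos α)]
  have pos : ∀ α, 0 ≤ (1 + r) ^ 2 / 4 * (1 + 1 ^ 2 - 2 * 1 * Real.cos α) := fun α => by
    have : 0 ≤ 1 + 1 ^ 2 - 2 * 1 * Real.cos α := by linarith [Real.cos_le_one α]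
    positivity
  have e : ((1 + r) ^ 2 * |Real.cos θ - Real.cos φ| / 2) ^ 2
      = ((1 + r) ^ 2 / 4) ^ 2 * abelPoly 1 (Real.cos θ) (Real.cos φ) := by
    rw [div_pow, mul_pow, sq_abs, abelPoly]; ring
  rw [e, abelPoly_cos_cos, abelPoly_cos_cos]
  calc _ = ((1 + r) ^ 2 / 4 * (1 + 1 ^ 2 - 2 * 1 * Real.cos (θ - φ))) *
        ((1 + r) ^ 2 / 4 * (1 + 1 ^ 2 - 2 * 1 * Real.cos (θ + φ))) := by ring
    _ ≤ _ := mul_le_mul (key _) (key _) (pos _) ((pos _).trans (key _))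

lemma neg_log_two_le_logKernel {x t : ℝ} (hx : x ∈ Icc (-1 : ℝ) 1) (ht : t ∈ Icc (-1 : ℝ) 1) :
    -Real.log 2 ≤ logKernel x t := by
  have h : |x - t| ≤ 2 := abs_le.2 ⟨by linarith [hx.1, ht.2], by linarith [hx.2, ht.1]⟩
  rcases (abs_nonneg (x - t)).eq_or_lt with h0 | h0
  · rw [logKernel, ← h0, Real.log_zero]
    linarith [Real.log_nonneg one_le_two]
  · exact neg_le_neg (Real.log_le_log h0 h)

lemma abs_abelKernel_le {r x t : ℝ} (hr0 : 0 ≤ r) (hr1 : r < 1) (hx : x ∈ Icc (-1 : ℝ) 1)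
    (ht : t ∈ Icc (-1 : ℝ) 1) (hxt : x ≠ t) :
    |abelKernel r x t| ≤ |logKernel x t| + 2 * Real.log 2 := by
  have hpos := abelPoly_pos hr0 hr1 hx ht
  have hd : 0 < |x - t| := abs_pos.2 (sub_ne_zero.2 hxt)
  have l2 := Real.log_nonneg one_le_two
  have h1 : Real.log (abelPoly r x t) ≤ 4 * Real.log 2 := by
    have := Real.log_le_log hpos (abelPoly_le hr0 hr1 hx ht)
    rw [Real.log_pow, show (4 : ℝ) = 2 ^ 2 by norm_num, Real.log_pow] at this
    push_cast at this; linarith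
  have h2 : 2 * (Real.log |x - t| - Real.log 2) ≤ Real.log (abelPoly r x t) := by
    have h3 : (|x - t| / 2) ^ 2 ≤ abelPoly r x t := by
      refine le_trans ?_ (le_abelPoly hr0 hx ht)
      gcongr
      exact le_mul_of_one_le_left hd.le (one_le_pow₀ (by linarith))
    have := Real.log_le_log (by positivity) h3
    rw [Real.log_pow, Real.log_div hd.ne' two_ne_zero] at this
    push_cast at this; linarith
  have h4 := le_abs_self (logKernel x t)
  have h5 := abs_nonneg (logKernel x t)
  simp only [abelKernel, logKernel] at *
  rw [abs_le]; constructor <;> linarith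

lemma tendsto_abelKernel {x t : ℝ} (hxt : x ≠ t) :
    Tendsto (fun r => abelKernel r x t) (𝓝[<] 1) (𝓝 (logKernel x t)) := by
  have hd : 0 < |x - t| := abs_pos.2 (sub_ne_zero.2 hxt)
  have e : abelPoly 1 x t = (2 * |x - t|) ^ 2 := by rw [mul_pow, sq_abs, abelPoly]; ring
  have e2 : abelKernel 1 x t = logKernel x t := by
    rw [abelKernel, e, Real.log_pow, Real.log_mul two_ne_zero hd.ne', logKernel]
    push_cast; ring
  rw [← e2]
  refine tendsto_nhdsWithin_of_tendsto_nhds (ContinuousAt.tendsto ?_)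
  have hc : Continuous fun r => abelPoly r x t := by unfold abelPoly; fun_prop
  unfold abelKernel
  refine continuousAt_const.sub ((ContinuousAt.log hc.continuousAt ?_).div_const 2)
  rw [e]; positivity

/-- The real part of the Taylor series of `-log (1 - r e^{iα})`. -/
lemma hasSum_cos_div {r : ℝ} (hr0 : 0 ≤ r) (hr1 : r < 1) (α : ℝ) :
    HasSum (fun n : ℕ => r ^ n / n * Real.cos (n * α))
      (-(Real.log (1 + r ^ 2 - 2 * r * Real.cos α) / 2)) := by
  set z : ℂ := r * Complex.exp (α * Complex.I) with hz
  have hn : ‖z‖ < 1 := by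
    rw [hz, norm_mul, Complex.norm_exp_ofReal_mul_I, mul_one, Complex.norm_real,
      Real.norm_of_nonneg hr0]
    exact hr1
  have h := Complex.hasSum_re (Complex.hasSum_taylorSeries_neg_log hn)
  convert! h using 1
  · ext n
    rw [hz, mul_pow, ← Complex.exp_nat_mul, ← mul_assoc, ← Complex.ofReal_natCast,
      ← Complex.ofReal_mul, ← Complex.ofReal_pow, Complex.div_ofReal_re, Complex.re_ofReal_mul,
      Complex.exp_ofReal_mul_I_re]
    ring
  · have hs : ‖1 - z‖ ^ 2 = 1 + r ^ 2 - 2 * r * Real.cos α := by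
      rw [← Complex.normSq_eq_norm_sq, Complex.normSq_apply, hz]
      simp only [Complex.sub_re, Complex.one_re, Complex.sub_im, Complex.one_im,
        Complex.re_ofReal_mul, Complex.im_ofReal_mul, Complex.exp_ofReal_mul_I_re,
        Complex.exp_ofReal_mul_I_im]
      linear_combination r ^ 2 * Real.sin_sq_add_cos_sq α
    rw [Complex.neg_re, Complex.log_re, ← hs, Real.log_pow]
    push_cast; ring

lemma hasSum_abelKernel {r x t : ℝ} (hr0 : 0 ≤ r) (hr1 : r < 1) (hx : x ∈ Icc (-1 : ℝ) 1)
    (ht : t ∈ Icc (-1 : ℝ) 1) :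
    HasSum (fun n : ℕ => 2 * r ^ n / n * ((Chebyshev.T ℝ n).eval x * (Chebyshev.T ℝ n).eval t))
      (abelKernel r x t - Real.log 2) := by
  obtain ⟨θ, rfl⟩ := exists_cos_eq hx
  obtain ⟨φ, rfl⟩ := exists_cos_eq ht
  have h := (hasSum_cos_div hr0 hr1 (θ - φ)).add (hasSum_cos_div hr0 hr1 (θ + φ))
  convert! h using 1
  · ext n
    simp only [Chebyshev.T_real_cos, Int.cast_natCast]
    rw [mul_sub, mul_add, Real.cos_sub, Real.cos_add]
    ring
  · rw [abelKernel, abelPoly_cos_cos, Real.log_mul (one_add_sq_sub_pos hr0 hr1 _).ne'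
      (one_add_sq_sub_pos hr0 hr1 _).ne']
    ring

lemma abs_eval_T_le_one {x : ℝ} (hx : x ∈ Icc (-1 : ℝ) 1) (n : ℤ) :
    |(Chebyshev.T ℝ n).eval x| ≤ 1 := by
  obtain ⟨θ, rfl⟩ := exists_cos_eq hx
  rw [Chebyshev.T_real_cos]
  exact Real.abs_cos_le_one _

end LogEquilibrium

/-! ### Positive definiteness of the logarithmic energy -/

namespace LogEquilibrium
open Filter Topology Polynomial

@[fun_prop]
lemma measurable_logKernel : Measurable (fun p : ℝ × ℝ => logKernel p.1 p.2) := by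
  unfold logKernel
  exact (Real.measurable_log.comp (by fun_prop : Measurable fun p : ℝ × ℝ => |p.1 - p.2|)).neg

@[fun_prop]
lemma measurable_abelKernel (r : ℝ) : Measurable (fun p : ℝ × ℝ => abelKernel r p.1 p.2) := by
  unfold abelKernel abelPoly
  exact measurable_const.sub ((Real.measurable_log.comp (by fun_prop)).div_const 2)

lemma tendsto_integral_abelKernel {α : Type*} [MeasurableSpace α] {m : Measure α}
    [IsFiniteMeasure m] {X T : α → ℝ} (hX : Measurable X) (hT : Measurable T)
    (hXm : ∀ᵐ a ∂m, X a ∈ Icc (-1 : ℝ) 1) (hTm : ∀ᵐ a ∂m, T a ∈ Icc (-1 : ℝ) 1)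
    (hne : ∀ᵐ a ∂m, X a ≠ T a) (hint : Integrable (fun a => logKernel (X a) (T a)) m) :
    Tendsto (fun r => ∫ a, abelKernel r (X a) (T a) ∂m) (𝓝[<] 1)
      (𝓝 (∫ a, logKernel (X a) (T a) ∂m)) := by
  refine tendsto_integral_filter_of_dominated_convergence
    (fun a => |logKernel (X a) (T a)| + 2 * Real.log 2) ?_ ?_ ?_ ?_
  · exact Eventually.of_forall fun r =>
      ((measurable_abelKernel r).comp (hX.prodMk hT)).aestronglyMeasurable
  · have h0 : ∀ᶠ r : ℝ in 𝓝[<] 1, 0 < r :=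
      nhdsWithin_le_nhds (lt_mem_nhds zero_lt_one)
    filter_upwards [self_mem_nhdsWithin, h0] with r hr1 hr0
    filter_upwards [hXm, hTm, hne] with a h1 h2 h3
    exact abs_abelKernel_le hr0.le hr1 h1 h2 h3
  · exact hint.abs.add (integrable_const _)
  · filter_upwards [hne] with a h3
    exact tendsto_abelKernel h3

/-- The Chebyshev moment `∫ T_n dμ`. -/
noncomputable def chebMoment (μ : Measure ℝ) (n : ℕ) : ℝ := ∫ x, (Chebyshev.T ℝ n).eval x ∂μ

lemma integrable_eval_of_ae_mem_Icc {μ : Measure ℝ} [IsFiniteMeasure μ]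
    (hμ : ∀ᵐ x ∂μ, x ∈ Icc (-1 : ℝ) 1) {f : ℝ → ℝ} (hf : Continuous f) : Integrable f μ := by
  have h : IntegrableOn f (Icc (-1) 1) μ := hf.continuousOn.integrableOn_compact isCompact_Icc
  rwa [IntegrableOn, Measure.restrict_eq_self_of_ae_mem hμ] at h

lemma ae_prod_mem {μ ν : Measure ℝ} [SFinite μ] [SFinite ν]
    (hμ : ∀ᵐ x ∂μ, x ∈ Icc (-1 : ℝ) 1) (hν : ∀ᵐ x ∂ν, x ∈ Icc (-1 : ℝ) 1) :
    ∀ᵐ p ∂μ.prod ν, p.1 ∈ Icc (-1 : ℝ) 1 ∧ p.2 ∈ Icc (-1 : ℝ) 1 :=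
  (Measure.quasiMeasurePreserving_fst.ae hμ).and (Measure.quasiMeasurePreserving_snd.ae hν)

/-- The regularized mutual energy is diagonal in the Chebyshev moments. -/
lemma hasSum_integral_abelKernel {μ ν : Measure ℝ} [IsProbabilityMeasure μ]
    [IsProbabilityMeasure ν] (hμ : ∀ᵐ x ∂μ, x ∈ Icc (-1 : ℝ) 1)
    (hν : ∀ᵐ x ∂ν, x ∈ Icc (-1 : ℝ) 1) {r : ℝ} (hr0 : 0 ≤ r) (hr1 : r < 1) :
    HasSum (fun n : ℕ => 2 * r ^ n / n * (chebMoment μ n * chebMoment ν n))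
      ((∫ p, abelKernel r p.1 p.2 ∂μ.prod ν) - Real.log 2) := by
  have hmem := ae_prod_mem hμ hν
  have hbd : ∀ n : ℕ, ∀ᵐ p ∂μ.prod ν, ‖2 * r ^ n / n *
      ((Chebyshev.T ℝ n).eval p.1 * (Chebyshev.T ℝ n).eval p.2)‖ ≤ 2 * r ^ n := fun n => by
    filter_upwards [hmem] with p hp
    have h1 := abs_eval_T_le_one hp.1 n
    have h2 := abs_eval_T_le_one hp.2 n
    have h3 : |(Chebyshev.T ℝ n).eval p.1 * (Chebyshev.T ℝ n).eval p.2| ≤ 1 := by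
      rw [abs_mul]; exact mul_le_one₀ h1 (abs_nonneg _) h2
    have h4 : 2 * r ^ n / n ≤ 2 * r ^ n := by
      rcases Nat.eq_zero_or_pos n with rfl | hn
      · simp
      · exact div_le_self (by positivity) (by exact_mod_cast hn)
    have h5 : 0 ≤ 2 * r ^ n / n := by positivity
    rw [Real.norm_eq_abs, abs_mul, abs_of_nonneg h5]
    calc _ ≤ 2 * r ^ n / n * 1 := by gcongr
      _ ≤ _ := by rw [mul_one]; exact h4
  have h := hasSum_integral_of_dominated_convergence (μ := μ.prod ν)
    (F := fun (n : ℕ) p => 2 * r ^ n / n *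
      ((Chebyshev.T ℝ n).eval p.1 * (Chebyshev.T ℝ n).eval p.2))
    (f := fun p => abelKernel r p.1 p.2 - Real.log 2) (fun n _ => 2 * r ^ n)
    (fun n => by
      refine Continuous.aestronglyMeasurable ?_
      have := (Chebyshev.T ℝ n).continuous
      fun_prop) hbd
    (Eventually.of_forall fun _ => (summable_geometric_of_lt_one hr0 hr1).mul_left 2)
    (integrable_const _)
    (by filter_upwards [hmem] with p hp using hasSum_abelKernel hr0 hr1 hp.1 hp.2)
  convert! h using 1
  · ext n
    rw [integral_const_mul, integral_prod_mul (fun x => (Chebyshev.T ℝ n).eval x)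
      (fun x => (Chebyshev.T ℝ n).eval x)]
    rfl
  · have hint : Integrable (fun p : ℝ × ℝ => abelKernel r p.1 p.2) (μ.prod ν) := by
      refine Integrable.of_bound (measurable_abelKernel r).aestronglyMeasurable
        (Real.log 2 + |∑' n : ℕ, 2 * r ^ n|) ?_
      filter_upwards [hmem, ae_all_iff.2 hbd] with p hp hb
      have hs := hasSum_abelKernel hr0 hr1 hp.1 hp.2
      have := hs.tsum_eq ▸ tsum_of_norm_bounded
        ((summable_geometric_of_lt_one hr0 hr1).mul_left 2).hasSum hb
      calc ‖abelKernel r p.1 p.2‖ = ‖Real.log 2 + (abelKernel r p.1 p.2 - Real.log 2)‖ := by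
            congr 1; ring
        _ ≤ ‖Real.log 2‖ + ‖abelKernel r p.1 p.2 - Real.log 2‖ := norm_add_le _ _
        _ ≤ _ := by
          rw [Real.norm_of_nonneg (Real.log_nonneg one_le_two)]
          gcongr
          exact this.trans (le_abs_self _)
    rw [integral_sub hint (integrable_const _), integral_const]
    simp

/-- Positive definiteness of the logarithmic kernel on `[-1, 1]`, in a quantitative form: the
energy of `μ - ν` dominates the contribution of each Chebyshev moment. For `n = 0` the factor
`2 / n` is `0` and the bound is plain nonnegativity. -/
lemma sq_chebMoment_sub_le {μ ν : Measure ℝ} [IsProbabilityMeasure μ]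
    [IsProbabilityMeasure ν] (hμ : ∀ᵐ x ∂μ, x ∈ Icc (-1 : ℝ) 1)
    (hν : ∀ᵐ x ∂ν, x ∈ Icc (-1 : ℝ) 1)
    (dμμ : ∀ᵐ p ∂μ.prod μ, p.1 ≠ p.2) (dμν : ∀ᵐ p ∂μ.prod ν, p.1 ≠ p.2)
    (dνν : ∀ᵐ p ∂ν.prod ν, p.1 ≠ p.2)
    (iμμ : Integrable (fun p : ℝ × ℝ => logKernel p.1 p.2) (μ.prod μ))
    (iμν : Integrable (fun p : ℝ × ℝ => logKernel p.1 p.2) (μ.prod ν))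
    (iνν : Integrable (fun p : ℝ × ℝ => logKernel p.1 p.2) (ν.prod ν)) (n : ℕ) :
    2 / n * (chebMoment μ n - chebMoment ν n) ^ 2 ≤
      (∫ p, logKernel p.1 p.2 ∂μ.prod μ) - 2 * (∫ p, logKernel p.1 p.2 ∂μ.prod ν) +
        ∫ p, logKernel p.1 p.2 ∂ν.prod ν := by
  have key : ∀ {μ ν : Measure ℝ} [IsProbabilityMeasure μ] [IsProbabilityMeasure ν],
      (∀ᵐ x ∂μ, x ∈ Icc (-1 : ℝ) 1) → (∀ᵐ x ∂ν, x ∈ Icc (-1 : ℝ) 1) →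
      (∀ᵐ p ∂μ.prod ν, p.1 ≠ p.2) →
      Integrable (fun p : ℝ × ℝ => logKernel p.1 p.2) (μ.prod ν) →
      Tendsto (fun r => ∫ p, abelKernel r p.1 p.2 ∂μ.prod ν) (𝓝[<] 1)
        (𝓝 (∫ p, logKernel p.1 p.2 ∂μ.prod ν)) := fun h1 h2 h3 h4 =>
    tendsto_integral_abelKernel measurable_fst measurable_snd
      ((ae_prod_mem h1 h2).mono fun _ h => h.1) ((ae_prod_mem h1 h2).mono fun _ h => h.2) h3 h4
  have hR := ((key hμ hμ dμμ iμμ).sub ((key hμ hν dμν iμν).const_mul 2)).add (key hν hν dνν iνν)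
  have hL : Tendsto (fun r : ℝ => 2 * r ^ n / n * (chebMoment μ n - chebMoment ν n) ^ 2) (𝓝[<] 1)
      (𝓝 (2 / n * (chebMoment μ n - chebMoment ν n) ^ 2)) := by
    refine tendsto_nhdsWithin_of_tendsto_nhds ?_
    have : Continuous fun r : ℝ => 2 * r ^ n / n * (chebMoment μ n - chebMoment ν n) ^ 2 := by
      fun_prop
    simpa using this.tendsto 1
  refine le_of_tendsto_of_tendsto hL hR ?_
  have h0 : ∀ᶠ r : ℝ in 𝓝[<] 1, 0 < r := nhdsWithin_le_nhds (lt_mem_nhds zero_lt_one)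
  filter_upwards [self_mem_nhdsWithin, h0] with r hr1 hr0
  have hs := ((hasSum_integral_abelKernel hμ hμ hr0.le hr1).sub
    ((hasSum_integral_abelKernel hμ hν hr0.le hr1).mul_left 2)).add
    (hasSum_integral_abelKernel hν hν hr0.le hr1)
  have hle := le_hasSum hs n fun k _ => by
    have : 0 ≤ 2 * r ^ k / k * (chebMoment μ k - chebMoment ν k) ^ 2 := by positivity
    linarith
  linarith

/-- The Chebyshev polynomials of the first kind as a sequence with one polynomial in each
degree. -/
noncomputable def chebSequence : Polynomial.Sequence ℝ where
  elems' n := Chebyshev.T ℝ n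
  degree_eq' n := by simp [Chebyshev.degree_T]

/-- A probability measure on `[-1, 1]` is determined by its Chebyshev moments. -/
lemma eq_of_chebMoment_eq {μ ν : Measure ℝ} [IsProbabilityMeasure μ]
    [IsProbabilityMeasure ν] (hμ : ∀ᵐ x ∂μ, x ∈ Icc (-1 : ℝ) 1)
    (hν : ∀ᵐ x ∂ν, x ∈ Icc (-1 : ℝ) 1) (h : ∀ n, chebMoment μ n = chebMoment ν n) : μ = ν := by
  have hpoly : ∀ p : ℝ[X], ∫ x, p.eval x ∂μ = ∫ x, p.eval x ∂ν := fun p => by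
    have hp : p ∈ Submodule.span ℝ (Set.range chebSequence) := by
      rw [chebSequence.span fun i => (leadingCoeff_ne_zero.2 (chebSequence.ne_zero i)).isUnit]
      trivial
    induction hp using Submodule.span_induction with
    | mem p hp => obtain ⟨n, rfl⟩ := hp; exact h n
    | zero => simp
    | add p q _ _ hp hq =>
      simp only [eval_add]
      rw [integral_add (integrable_eval_of_ae_mem_Icc hμ p.continuous)
        (integrable_eval_of_ae_mem_Icc hμ q.continuous), hp, hq,
        integral_add (integrable_eval_of_ae_mem_Icc hν p.continuous)
        (integrable_eval_of_ae_mem_Icc hν q.continuous)]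
    | smul a p _ hp => simp only [eval_smul, smul_eq_mul, integral_const_mul, hp]
  refine ext_of_forall_integral_eq_of_IsFiniteMeasure fun f => ?_
  refine eq_of_forall_dist_le fun ε hε => ?_
  obtain ⟨p, hp⟩ := exists_polynomial_near_of_continuousOn (-1) 1 f f.continuous.continuousOn
    (ε / 2) (by positivity)
  have key : ∀ {μ : Measure ℝ} [IsProbabilityMeasure μ], (∀ᵐ x ∂μ, x ∈ Icc (-1 : ℝ) 1) →
      |∫ x, f x ∂μ - ∫ x, p.eval x ∂μ| ≤ ε / 2 := fun {μ} _ hμ => by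
    rw [← integral_sub (integrable_eval_of_ae_mem_Icc hμ f.continuous)
      (integrable_eval_of_ae_mem_Icc hμ p.continuous)]
    have := norm_integral_le_of_norm_le_const (μ := μ) (f := fun x => f x - p.eval x)
      (C := ε / 2) (by
        filter_upwards [hμ] with x hx
        rw [Real.norm_eq_abs, abs_sub_comm]; exact (hp x hx).le)
    simpa using this
  have h1 := key hμ
  have h2 := key hν
  rw [hpoly p] at h1
  rw [Real.dist_eq]
  rw [abs_le] at *
  constructor <;> linarith [h1.1, h1.2, h2.1, h2.2]

end LogEquilibrium

/-! ### Potentials in the angular variable -/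

namespace LogEquilibrium
open Filter Topology Polynomial ComplexConjugate
open InnerProductSpace (HarmonicOnNhd)

lemma circleAverage_eq_of_conj_invariant {h : ℂ → ℝ}
    (hcont : Continuous fun φ => h (circleMap 0 1 φ)) (hs : ∀ z, h (conj z) = h z) :
    Real.circleAverage h 0 1 = Real.pi⁻¹ * ∫ φ in (0 : ℝ)..Real.pi, h (circleMap 0 1 φ) := by
  have hrefl : ∀ φ : ℝ, h (circleMap 0 1 (2 * Real.pi - φ)) = h (circleMap 0 1 φ) := fun φ => by
    rw [← hs (circleMap 0 1 φ)]
    congr 1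
    simp only [circleMap, zero_add, Complex.ofReal_one, one_mul, ← Complex.exp_conj, map_mul,
      Complex.conj_ofReal, Complex.conj_I]
    rw [Complex.exp_eq_exp_iff_exists_int]
    exact ⟨1, by push_cast; ring⟩
  have h2 : ∫ φ in Real.pi..(2 * Real.pi), h (circleMap 0 1 φ)
      = ∫ φ in (0 : ℝ)..Real.pi, h (circleMap 0 1 φ) := by
    have := intervalIntegral.integral_comp_sub_left (a := 0) (b := Real.pi)
      (fun φ => h (circleMap 0 1 φ)) (2 * Real.pi)
    simp only [hrefl] at this
    rw [this]
    congr 1 <;> ring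
  rw [Real.circleAverage_def, ← intervalIntegral.integral_add_adjacent_intervals
    (hcont.intervalIntegrable 0 Real.pi) (hcont.intervalIntegrable Real.pi (2 * Real.pi)), h2,
    smul_eq_mul]
  field_simp
  ring

/-- The density on `(0, π)`, in the angle `φ`, of `1 + γ` times the arcsine distribution minus `γ`
times the swept Dirac mass at the exterior point `-(q + 1 / q) / 2`; the latter is the Poisson
kernel of the unit disc at the point `-q`. -/
noncomputable def angleDensity (γ q φ : ℝ) : ℝ :=
  Real.pi⁻¹ * (1 + γ - γ * ((1 - q ^ 2) / (1 + 2 * q * Real.cos φ + q ^ 2)))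

lemma poisson_denom_pos {q : ℝ} (hq0 : 0 ≤ q) (hq1 : q < 1) (φ : ℝ) :
    0 < 1 + 2 * q * Real.cos φ + q ^ 2 := by
  nlinarith [Real.neg_one_le_cos φ, sq_pos_of_pos (sub_pos.2 hq1)]

lemma continuous_angleDensity {γ q : ℝ} (hq0 : 0 ≤ q) (hq1 : q < 1) :
    Continuous (angleDensity γ q) := by
  unfold angleDensity
  have := fun φ => (poisson_denom_pos hq0 hq1 φ).ne'
  fun_prop (disch := assumption)

lemma angleDensity_nonneg {γ q : ℝ} (hγ : 0 ≤ γ) (hq0 : 0 ≤ q) (hq1 : q < 1)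
    (h : γ * (1 + q) ≤ (1 + γ) * (1 - q)) (φ : ℝ) : 0 ≤ angleDensity γ q φ := by
  have hd := poisson_denom_pos hq0 hq1 φ
  refine mul_nonneg (by positivity) ?_
  rw [sub_nonneg, ← mul_div_assoc, div_le_iff₀ hd]
  calc γ * (1 - q ^ 2) = (γ * (1 + q)) * (1 - q) := by ring
    _ ≤ ((1 + γ) * (1 - q)) * (1 - q) := by gcongr
    _ = (1 + γ) * (1 - q) ^ 2 := by ring
    _ ≤ _ := by
      have : 0 ≤ 1 + γ := by linarith
      gcongr
      nlinarith [Real.neg_one_le_cos φ]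

/-- Poisson's formula for functions symmetric about the real axis. -/
lemma integral_angleDensity_mul {γ q : ℝ} (hq0 : 0 ≤ q) (hq1 : q < 1) {h : ℂ → ℝ}
    (hh : HarmonicOnNhd h (Metric.closedBall 0 1)) (hs : ∀ z, h (conj z) = h z) :
    ∫ φ in (0 : ℝ)..Real.pi, angleDensity γ q φ * h (circleMap 0 1 φ)
      = (1 + γ) * h 0 - γ * h (-q) := by
  have hball : (-q : ℂ) ∈ Metric.ball (0 : ℂ) 1 := by
    simp [abs_of_nonneg hq0, hq1]
  have hcont : Continuous fun φ => h (circleMap 0 1 φ) :=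
    hh.continuousOn.comp_continuous (continuous_circleMap 0 1)
      fun φ => circleMap_mem_closedBall 0 zero_le_one φ
  have e1 : ∀ φ : ℝ, poissonKernel 0 (-q) (circleMap 0 1 φ)
      = (1 - q ^ 2) / (1 + 2 * q * Real.cos φ + q ^ 2) := fun φ => by
    rw [poissonKernel_def]
    congr 1
    · simp
    · rw [← Complex.normSq_eq_norm_sq, Complex.normSq_apply]
      simp only [circleMap, zero_add, Complex.ofReal_one, one_mul, sub_zero, sub_neg_eq_add,
        Complex.add_re, Complex.add_im, Complex.ofReal_re, Complex.ofReal_im,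
        Complex.exp_ofReal_mul_I_re, Complex.exp_ofReal_mul_I_im]
      linear_combination Real.sin_sq_add_cos_sq φ
  have hcontP : Continuous fun φ => (poissonKernel 0 (-q) • h) (circleMap 0 1 φ) := by
    simp only [Pi.smul_apply', e1, smul_eq_mul]
    refine Continuous.mul (Continuous.div (by fun_prop) (by fun_prop) fun φ => ?_) hcont
    exact (poisson_denom_pos hq0 hq1 φ).ne'
  have hsP : ∀ z, (poissonKernel 0 (-q) • h) (conj z) = (poissonKernel 0 (-q) • h) z := fun z => by
    simp only [Pi.smul_apply', hs, poissonKernel_def, sub_zero, sub_neg_eq_add, RCLike.norm_conj]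
    rw [← RCLike.norm_conj (z + q), map_add, Complex.conj_ofReal]
  have h1 := hh.circleAverage_poissonKernel_smul hball
  have h0 : Real.circleAverage h 0 1 = h 0 :=
    InnerProductSpace.HarmonicOnNhd.circleAverage_eq (by rwa [abs_one])
  rw [circleAverage_eq_of_conj_invariant hcontP hsP] at h1
  rw [circleAverage_eq_of_conj_invariant hcont hs] at h0
  rw [← h0, ← h1, ← mul_assoc, ← mul_assoc, ← intervalIntegral.integral_const_mul,
    ← intervalIntegral.integral_const_mul, ← intervalIntegral.integral_sub
    ((hcont.const_mul _).intervalIntegrable _ _) ((hcontP.const_mul _).intervalIntegrable _ _)]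
  refine intervalIntegral.integral_congr fun φ _ => ?_
  simp only [Pi.smul_apply', e1, smul_eq_mul, angleDensity]
  ring

/-- `abelPoly r w` on the circle is the squared modulus of a quadratic polynomial without zeros in
the closed disc. -/
lemma norm_sq_quadratic_circleMap (r w φ : ℝ) :
    ‖1 - 2 * r * w * circleMap 0 1 φ + r ^ 2 * circleMap 0 1 φ ^ 2‖ ^ 2
      = abelPoly r w (Real.cos φ) := by
  have e : (1 - 2 * r * w * circleMap 0 1 φ + r ^ 2 * circleMap 0 1 φ ^ 2 : ℂ)
      = ((1 - 2 * r * w * Real.cos φ + r ^ 2 * (Real.cos φ ^ 2 - Real.sin φ ^ 2) : ℝ) : ℂ)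
        + ((2 * r ^ 2 * Real.sin φ * Real.cos φ - 2 * r * w * Real.sin φ : ℝ) : ℂ)
          * Complex.I := by
    simp only [circleMap, zero_add, Complex.ofReal_one, one_mul, Complex.exp_mul_I]
    push_cast
    linear_combination (r ^ 2 * Complex.sin φ ^ 2 : ℂ) * Complex.I_sq
  rw [e, ← Complex.normSq_eq_norm_sq, Complex.normSq_add_mul_I, abelPoly]
  have h : Real.sin φ ^ 2 = 1 - Real.cos φ ^ 2 := by linarith [Real.sin_sq_add_cos_sq φ]
  have h4 : Real.sin φ ^ 4 = (1 - Real.cos φ ^ 2) ^ 2 := by rw [← h]; ring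
  linear_combination (r ^ 4) * h4 + (-2 * r ^ 2 * (1 - 2 * r * w * Real.cos φ
    + r ^ 2 * Real.cos φ ^ 2) + (2 * r ^ 2 * Real.cos φ - 2 * r * w) ^ 2) * h

lemma quadratic_ne_zero {r w : ℝ} (hr0 : 0 ≤ r) (hr1 : r < 1) (hw : w ∈ Icc (-1 : ℝ) 1) {z : ℂ}
    (hz : ‖z‖ ≤ 1) : (1 - 2 * r * w * z + r ^ 2 * z ^ 2 : ℂ) ≠ 0 := by
  obtain ⟨θ, rfl⟩ := exists_cos_eq hw
  have e : (1 - 2 * r * Real.cos θ * z + r ^ 2 * z ^ 2 : ℂ)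
      = (1 - r * Complex.exp (θ * Complex.I) * z)
        * (1 - r * Complex.exp ((-θ : ℝ) * Complex.I) * z) := by
    have h1 : Complex.exp (θ * Complex.I) * Complex.exp ((-θ : ℝ) * Complex.I) = 1 := by
      rw [← Complex.exp_add, Complex.ofReal_neg, neg_mul, add_neg_cancel, Complex.exp_zero]
    have h2 : (2 * Real.cos θ : ℂ)
        = Complex.exp (θ * Complex.I) + Complex.exp ((-θ : ℝ) * Complex.I) := by
      rw [Complex.ofReal_cos, Complex.two_cos, Complex.ofReal_neg]
    linear_combination (-r * z : ℂ) * h2 - (r ^ 2 * z ^ 2 : ℂ) * h1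
  have key : ∀ α : ℝ, (1 - r * Complex.exp (α * Complex.I) * z : ℂ) ≠ 0 := fun α h0 => by
    have h1 : ‖(r * Complex.exp (α * Complex.I) * z : ℂ)‖ < 1 := by
      rw [norm_mul, norm_mul, Complex.norm_exp_ofReal_mul_I, mul_one, Complex.norm_real,
        Real.norm_of_nonneg hr0]
      nlinarith [norm_nonneg z]
    rw [← sub_eq_zero.1 h0, norm_one] at h1
    exact lt_irrefl _ h1
  rw [e]
  exact mul_ne_zero (key θ) (key (-θ))

lemma one_add_two_mul_pos {q w : ℝ} (hq0 : 0 ≤ q) (hq1 : q < 1) (hw : -1 ≤ w) :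
    0 < 1 + 2 * q * w + q ^ 2 := by
  nlinarith [sq_pos_of_pos (sub_pos.2 hq1)]

/-- The regularized potential, by Poisson's formula for `log |1 - 2 r w z + r² z²|`. -/
lemma integral_angleDensity_mul_abelKernel {γ q r w : ℝ} (hq0 : 0 ≤ q) (hq1 : q < 1)
    (hr0 : 0 ≤ r) (hr1 : r < 1) (hw : w ∈ Icc (-1 : ℝ) 1) :
    ∫ φ in (0 : ℝ)..Real.pi, angleDensity γ q φ * abelKernel r w (Real.cos φ)
      = Real.log 2 + γ * Real.log (1 + 2 * (r * q) * w + (r * q) ^ 2) := by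
  have hlog : HarmonicOnNhd (fun z : ℂ => Real.log ‖(1 - 2 * r * w * z + r ^ 2 * z ^ 2 : ℂ)‖)
      (Metric.closedBall 0 1) := fun z hz =>
    AnalyticAt.harmonicAt_log_norm (by fun_prop)
      (quadratic_ne_zero hr0 hr1 hw (mem_closedBall_zero_iff.1 hz))
  have hharm : HarmonicOnNhd
      ((fun _ : ℂ => Real.log 2) - fun z : ℂ =>
        Real.log ‖(1 - 2 * r * w * z + r ^ 2 * z ^ 2 : ℂ)‖) (Metric.closedBall 0 1) :=
    HarmonicOnNhd.sub (InnerProductSpace.harmonicOnNhd_const _) hlog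
  have h := integral_angleDensity_mul (γ := γ) hq0 hq1 hharm fun z => by
    simp only [Pi.sub_apply]
    rw [← RCLike.norm_conj (1 - 2 * r * w * z + r ^ 2 * z ^ 2 : ℂ)]
    simp [Complex.conj_ofNat]
  have hrq : 0 < 1 + 2 * (r * q) * w + (r * q) ^ 2 :=
    one_add_two_mul_pos (by positivity) (by nlinarith) hw.1
  have e0 : (1 - 2 * r * w * (-q) + r ^ 2 * (-q) ^ 2 : ℂ)
      = ((1 + 2 * (r * q) * w + (r * q) ^ 2 : ℝ) : ℂ) := by push_cast; ring
  simp only [Pi.sub_apply, e0, Complex.norm_real, Real.norm_of_nonneg hrq.le] at h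
  simp only [mul_zero, sub_zero, ne_eq, OfNat.ofNat_ne_zero, not_false_eq_true, zero_pow,
    add_zero, norm_one, Real.log_one] at h
  have : ∀ φ : ℝ, abelKernel r w (Real.cos φ) = Real.log 2 -
      Real.log ‖1 - 2 * r * w * circleMap 0 1 φ + r ^ 2 * circleMap 0 1 φ ^ 2‖ := fun φ => by
    rw [abelKernel, ← norm_sq_quadratic_circleMap, Real.log_pow]
    push_cast; ring
  simp only [this]
  rw [h]
  ring

/-- The probability measure on `(0, π)` with density `angleDensity`. -/
noncomputable def angleMeasure (γ q : ℝ) : Measure ℝ :=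
  (volume.restrict (Ioo 0 Real.pi)).withDensity fun φ => ENNReal.ofReal (angleDensity γ q φ)

lemma integral_angleMeasure {γ q : ℝ} (hq0 : 0 ≤ q) (hq1 : q < 1)
    (hnn : ∀ φ, 0 ≤ angleDensity γ q φ) (f : ℝ → ℝ) :
    ∫ φ, f φ ∂angleMeasure γ q = ∫ φ in (0 : ℝ)..Real.pi, angleDensity γ q φ * f φ := by
  rw [angleMeasure, integral_withDensity_eq_integral_toReal_smul
    (continuous_angleDensity hq0 hq1).measurable.ennreal_ofReal
    (Eventually.of_forall fun _ => ENNReal.ofReal_lt_top),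
    intervalIntegral.integral_of_le Real.pi_pos.le, integral_Ioc_eq_integral_Ioo]
  simp only [ENNReal.toReal_ofReal (hnn _), smul_eq_mul]

lemma integrable_angleMeasure {γ q : ℝ} (hq0 : 0 ≤ q) (hq1 : q < 1)
    (hnn : ∀ φ, 0 ≤ angleDensity γ q φ) {f : ℝ → ℝ}
    (hf : IntervalIntegrable f volume 0 Real.pi) : Integrable f (angleMeasure γ q) := by
  rw [angleMeasure, integrable_withDensity_iff_integrable_smul'
    (continuous_angleDensity hq0 hq1).measurable.ennreal_ofReal
    (Eventually.of_forall fun _ => ENNReal.ofReal_lt_top)]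
  simp only [ENNReal.toReal_ofReal (hnn _), smul_eq_mul]
  have := hf.continuousOn_mul (continuous_angleDensity (γ := γ) hq0 hq1).continuousOn
  rw [intervalIntegrable_iff_integrableOn_Ioo_of_le Real.pi_pos.le] at this
  exact this

lemma isProbabilityMeasure_angleMeasure {γ q : ℝ} (hq0 : 0 ≤ q) (hq1 : q < 1)
    (hnn : ∀ φ, 0 ≤ angleDensity γ q φ) : IsProbabilityMeasure (angleMeasure γ q) := by
  have h := integral_angleDensity_mul (γ := γ) hq0 hq1 (h := fun _ => 1)
    (InnerProductSpace.harmonicOnNhd_const 1) fun _ => rfl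
  have hfin : IsFiniteMeasure (angleMeasure γ q) := by
    have := integrable_angleMeasure (γ := γ) hq0 hq1 hnn (f := fun _ => (1 : ℝ)) (by simp)
    exact (integrable_const_iff_isFiniteMeasure one_ne_zero).1 this
  rw [← integral_angleMeasure hq0 hq1 hnn, integral_const, smul_eq_mul, mul_one] at h
  refine ⟨?_⟩
  rw [Measure.real, show (1 + γ) * 1 - γ * 1 = 1 by ring] at h
  exact (ENNReal.toReal_eq_one_iff _).1 h

lemma ae_angleMeasure_cos_ne (γ q w : ℝ) : ∀ᵐ φ ∂angleMeasure γ q, w ≠ Real.cos φ := by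
  refine (withDensity_absolutelyContinuous _ _).ae_le
    ((ae_restrict_iff' measurableSet_Ioo).2 ?_)
  have : ∀ᵐ φ : ℝ, φ ≠ Real.arccos w := by
    simp [ae_iff]
  filter_upwards [this] with φ hφ hm h0
  exact hφ (by rw [h0, Real.arccos_cos hm.1.le hm.2.le])

lemma ae_angleMeasure_mem (γ q : ℝ) : ∀ᵐ φ ∂angleMeasure γ q, φ ∈ Ioo 0 Real.pi :=
  (withDensity_absolutelyContinuous _ _).ae_le (ae_restrict_mem measurableSet_Ioo)

lemma integrable_logKernel_cos {γ q : ℝ} (hq0 : 0 ≤ q) (hq1 : q < 1)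
    (hnn : ∀ φ, 0 ≤ angleDensity γ q φ) (w : ℝ) :
    Integrable (fun φ => logKernel w (Real.cos φ)) (angleMeasure γ q) := by
  refine integrable_angleMeasure hq0 hq1 hnn ?_
  -- The logarithm of the norm of a meromorphic function is locally integrable.
  have : MeromorphicOn (fun φ => w - Real.cos φ) (uIcc 0 Real.pi) := fun x _ =>
    (analyticAt_const.sub Real.analyticAt_cos).meromorphicAt
  exact this.intervalIntegrable_log_norm.neg

/-- The potential on the support. -/
lemma integral_logKernel_cos_of_mem_Icc {γ q w : ℝ} (hq0 : 0 ≤ q) (hq1 : q < 1)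
    (hnn : ∀ φ, 0 ≤ angleDensity γ q φ) (hw : w ∈ Icc (-1 : ℝ) 1) :
    ∫ φ, logKernel w (Real.cos φ) ∂angleMeasure γ q
      = Real.log 2 + γ * Real.log (1 + 2 * q * w + q ^ 2) := by
  have := isProbabilityMeasure_angleMeasure hq0 hq1 hnn
  have h1 := tendsto_integral_abelKernel (m := angleMeasure γ q) (X := fun _ => w) measurable_const
    Real.measurable_cos (ae_of_all _ fun _ => hw) (ae_of_all _ fun φ => Real.cos_mem_Icc φ)
    (ae_angleMeasure_cos_ne γ q w) (integrable_logKernel_cos hq0 hq1 hnn w)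
  have h2 : Tendsto (fun r : ℝ => Real.log 2 + γ * Real.log (1 + 2 * (r * q) * w + (r * q) ^ 2))
      (𝓝[<] 1) (𝓝 (Real.log 2 + γ * Real.log (1 + 2 * (1 * q) * w + (1 * q) ^ 2))) := by
    refine tendsto_nhdsWithin_of_tendsto_nhds (ContinuousAt.tendsto ?_)
    have hp : 1 + 2 * (1 * q) * w + (1 * q) ^ 2 ≠ 0 := by
      rw [one_mul]; exact (one_add_two_mul_pos hq0 hq1 hw.1).ne'
    refine continuousAt_const.add (continuousAt_const.mul (ContinuousAt.log ?_ hp))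
    fun_prop
  rw [one_mul] at h2
  refine tendsto_nhds_unique h1 (h2.congr' ?_)
  have h0 : ∀ᶠ r : ℝ in 𝓝[<] 1, 0 < r := nhdsWithin_le_nhds (lt_mem_nhds zero_lt_one)
  filter_upwards [self_mem_nhdsWithin, h0] with r hr1 hr0
  rw [integral_angleMeasure hq0 hq1 hnn,
    integral_angleDensity_mul_abelKernel hq0 hq1 hr0.le hr1 hw]

/-- The potential to the left of the support, at the point `-(z + 1 / z) / 2`. -/
lemma integral_logKernel_cos_of_lt {γ q z : ℝ} (hq0 : 0 ≤ q) (hq1 : q < 1)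
    (hnn : ∀ φ, 0 ≤ angleDensity γ q φ) (hz0 : 0 < z) (hz1 : z < 1) :
    ∫ φ, logKernel (-(z + 1 / z) / 2) (Real.cos φ) ∂angleMeasure γ q
      = Real.log (2 * z) + 2 * γ * Real.log (1 - z * q) := by
  have h := integral_angleDensity_mul_abelKernel (γ := γ) hq0 hq1 hz0.le hz1
    (w := -1) (by simp)
  have := isProbabilityMeasure_angleMeasure hq0 hq1 hnn
  rw [← integral_angleMeasure hq0 hq1 hnn] at h
  have e : ∀ φ, logKernel (-(z + 1 / z) / 2) (Real.cos φ)
      = Real.log z + abelKernel z (-1) (Real.cos φ) := fun φ => by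
    have hp := poisson_denom_pos hz0.le hz1 φ
    have e1 : abelPoly z (-1) (Real.cos φ) = (1 + 2 * z * Real.cos φ + z ^ 2) ^ 2 := by
      rw [abelPoly]; ring
    have e2 : -(z + 1 / z) / 2 - Real.cos φ = -((1 + 2 * z * Real.cos φ + z ^ 2) / (2 * z)) := by
      field_simp; ring
    rw [logKernel, e2, abs_neg, Real.log_abs, abelKernel, e1, Real.log_pow,
      Real.log_div hp.ne' (by positivity), Real.log_mul two_ne_zero hz0.ne']
    push_cast; ring
  have hzq : 0 < 1 - z * q := by nlinarith
  have e3 : 1 + 2 * (z * q) * (-1) + (z * q) ^ 2 = (1 - z * q) ^ 2 := by ring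
  have hint : Integrable (fun φ => abelKernel z (-1) (Real.cos φ)) (angleMeasure γ q) := by
    have := (integrable_logKernel_cos hq0 hq1 hnn (-(z + 1 / z) / 2)).sub
      (integrable_const (Real.log z))
    simpa only [e, Pi.sub_def, add_sub_cancel_left] using this
  simp only [e]
  rw [integral_add (integrable_const _) hint, h, e3, Real.log_pow, integral_const,
    Real.log_mul two_ne_zero hz0.ne']
  simp
  ring

end LogEquilibrium

/-! ### The equilibrium measure in the angular variable -/

namespace LogEquilibrium
open Filter Topology

/-- The Joukowski parametrization of the half-line to the left of `[-1, 1]`. -/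
lemma exists_joukowski {w : ℝ} (hw : w < -1) : ∃ z, 0 < z ∧ z < 1 ∧ w = -(z + 1 / z) / 2 := by
  have h1 : 0 < w ^ 2 - 1 := by nlinarith
  have hs := Real.sq_sqrt h1.le
  have hs0 := Real.sqrt_pos.2 h1
  have hz0 : 0 < -w - √(w ^ 2 - 1) := by nlinarith
  refine ⟨-w - √(w ^ 2 - 1), hz0, by nlinarith, ?_⟩
  field_simp
  nlinarith

lemma integral_logKernel_cos_le {γ q w : ℝ} (hγ : 0 ≤ γ) (hq0 : 0 ≤ q) (hq1 : q < 1)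
    (hnn : ∀ φ, 0 ≤ angleDensity γ q φ) (hw : w ≤ 1) :
    ∫ φ, logKernel w (Real.cos φ) ∂angleMeasure γ q ≤ Real.log 2 + γ * Real.log 4 := by
  rcases lt_or_ge w (-1) with h | h
  · obtain ⟨z, hz0, hz1, rfl⟩ := exists_joukowski h
    rw [integral_logKernel_cos_of_lt hq0 hq1 hnn hz0 hz1, Real.log_mul two_ne_zero hz0.ne']
    have h1 : Real.log z ≤ 0 := Real.log_nonpos hz0.le hz1.le
    have h2 : Real.log (1 - z * q) ≤ 0 := Real.log_nonpos (by nlinarith) (by nlinarith)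
    have h3 := Real.log_nonneg (by norm_num : (1 : ℝ) ≤ 4)
    nlinarith
  · rw [integral_logKernel_cos_of_mem_Icc hq0 hq1 hnn ⟨h, hw⟩]
    gcongr
    · exact one_add_two_mul_pos hq0 hq1 h
    · nlinarith

/-- In the critical case `γ (1 + q) = (1 + γ) (1 - q)` the difference of Green functions that
measures the excess of the total potential off the support is nonnegative: it vanishes at the edge
`z = 1` of the support and is decreasing on `(q, 1]`. -/
lemma green_excess_nonneg {γ q z : ℝ} (hγ : 0 ≤ γ) (hq0 : 0 ≤ q) (hq1 : q < 1)
    (hcrit : γ * (1 + q) = (1 + γ) * (1 - q)) (hqz : q < z) (hz1 : z ≤ 1) :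
    0 ≤ (1 + γ) * Real.log z + γ * Real.log (1 - z * q) - γ * Real.log (z - q) := by
  set G : ℝ → ℝ := fun z => (1 + γ) * Real.log z + γ * Real.log (1 - z * q) - γ * Real.log (z - q)
    with hG
  have hd : ∀ z ∈ Ioc q 1, HasDerivAt G
      ((1 + γ) * z⁻¹ + γ * (-q / (1 - z * q)) - γ * (1 / (z - q))) z := fun z hz => by
    have h1 : 1 - z * q ≠ 0 := by nlinarith [hz.1, hz.2]
    have h2 : z - q ≠ 0 := (sub_pos.2 hz.1).ne'
    have h3 : z ≠ 0 := (hq0.trans_lt hz.1).ne'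
    have d1 : HasDerivAt (fun z => 1 - z * q) (-q) z := by
      simpa using ((hasDerivAt_id z).mul_const q).const_sub 1
    have d2 : HasDerivAt (fun z => z - q) 1 z := (hasDerivAt_id z).sub_const q
    exact (((Real.hasDerivAt_log h3).const_mul _).add ((d1.log h1).const_mul _)).sub
      ((d2.log h2).const_mul _)
  have hanti : AntitoneOn G (Ioc q 1) := by
    refine antitoneOn_of_deriv_nonpos (convex_Ioc q 1)
      (fun z hz => (hd z hz).continuousAt.continuousWithinAt)
      (fun z hz => (hd z (interior_subset hz)).differentiableAt.differentiableWithinAt)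
      fun z hz => ?_
    have hz' := interior_subset hz
    rw [(hd z hz').deriv]
    have h1 : 0 < 1 - z * q := by nlinarith [hz'.1, hz'.2]
    have h2 : 0 < z - q := sub_pos.2 hz'.1
    have h3 : 0 < z := hq0.trans_lt hz'.1
    have e : (1 + γ) * z⁻¹ + γ * (-q / (1 - z * q)) - γ * (1 / (z - q))
        = ((1 + γ) * ((1 - z * q) * (z - q)) - γ * (1 + q) * (1 - q) * z)
          / (z * (1 - z * q) * (z - q)) := by
      field_simp; ring
    rw [e, hcrit]
    refine div_nonpos_of_nonpos_of_nonneg ?_ (by positivity)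
    have : (1 + γ) * ((1 - z * q) * (z - q)) - (1 + γ) * (1 - q) * (1 - q) * z
        = -((1 + γ) * (q * (1 - z) ^ 2)) := by ring
    rw [this, neg_nonpos]
    positivity
  have h1 : G 1 = 0 := by simp [hG]
  rw [← h1]
  exact hanti ⟨hqz, hz1⟩ ⟨hq1, le_rfl⟩ hz1

lemma le_integral_logKernel_cos {γ q w : ℝ} (hγ : 0 ≤ γ) (hq0 : 0 ≤ q) (hq1 : q < 1)
    (hnn : ∀ φ, 0 ≤ angleDensity γ q φ) (hcrit : γ * (1 + q) = (1 + γ) * (1 - q))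
    (hw : w < -1) (hpos : 0 < 1 + 2 * q * w + q ^ 2) :
    Real.log 2 + γ * Real.log (1 + 2 * q * w + q ^ 2)
      ≤ ∫ φ, logKernel w (Real.cos φ) ∂angleMeasure γ q := by
  obtain ⟨z, hz0, hz1, rfl⟩ := exists_joukowski hw
  rw [integral_logKernel_cos_of_lt hq0 hq1 hnn hz0 hz1, Real.log_mul two_ne_zero hz0.ne']
  have e : 1 + 2 * q * (-(z + 1 / z) / 2) + q ^ 2 = (z - q) * (1 - z * q) / z := by
    field_simp; ring
  rw [e] at hpos ⊢
  have h1 : 0 < 1 - z * q := by nlinarith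
  have h2 : 0 < z - q := by
    by_contra! h
    have : (z - q) * (1 - z * q) / z ≤ 0 :=
      div_nonpos_of_nonpos_of_nonneg (mul_nonpos_of_nonpos_of_nonneg h h1.le) hz0.le
    linarith
  have := green_excess_nonneg hγ hq0 hq1 hcrit (sub_pos.1 h2) hz1.le
  rw [Real.log_div (mul_pos h2 h1).ne' hz0.ne', Real.log_mul h2.ne' h1.ne']
  linarith

/-- The ratio `q` for which `-(q + 1 / q) / 2` is the position of `-y²` in the coordinate that
maps `[r², 1]` affinely onto `[-1, 1]`. -/
noncomputable def sweepRatio (y r : ℝ) : ℝ :=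
  (√(1 + y ^ 2) - √(r ^ 2 + y ^ 2)) / (√(1 + y ^ 2) + √(r ^ 2 + y ^ 2))

/-- The positive square root of the point `(1 + r²) / 2 + (1 - r²) / 2 * cos φ` of `[r², 1]`. -/
noncomputable def radiusOfAngle (r φ : ℝ) : ℝ :=
  √((1 + r ^ 2) / 2 + (1 - r ^ 2) / 2 * Real.cos φ)

/-- The common form of the two equilibrium densities, on `r < |x| < 1`. -/
noncomputable def shellDensity (γ y r x : ℝ) : ℝ :=
  Real.pi⁻¹ * (1 + γ - γ * (√(1 + y ^ 2) * √(r ^ 2 + y ^ 2) / (x ^ 2 + y ^ 2))) *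
    (|x| / √((x ^ 2 - r ^ 2) * (1 - x ^ 2)))

/-- The measure on `r < |x| < 1` with density `shellDensity`. -/
noncomputable def shellMeasure (γ y r : ℝ) : Measure ℝ :=
  (volume.restrict {x : ℝ | r < |x| ∧ |x| < 1}).withDensity
    fun x => ENNReal.ofReal (shellDensity γ y r x)

section Sweep

variable {y r : ℝ}

lemma sqrt_lt_sqrt_shell (hr0 : 0 ≤ r) (hr1 : r < 1) : √(r ^ 2 + y ^ 2) < √(1 + y ^ 2) :=
  Real.sqrt_lt_sqrt (by positivity) (by nlinarith)

lemma sweepRatio_pos (hr0 : 0 ≤ r) (hr1 : r < 1) : 0 < sweepRatio y r :=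
  div_pos (sub_pos.2 (sqrt_lt_sqrt_shell hr0 hr1)) (by positivity)

lemma sweepRatio_lt_one (hry : 0 < r ^ 2 + y ^ 2) : sweepRatio y r < 1 := by
  have : 0 < √(r ^ 2 + y ^ 2) := Real.sqrt_pos.2 hry
  rw [sweepRatio, div_lt_one (by positivity)]
  linarith

/-- The constant ratio of `x² + y²` to the denominator of the Poisson kernel. -/
noncomputable def sweepScale (y r : ℝ) : ℝ := (√(1 + y ^ 2) + √(r ^ 2 + y ^ 2)) ^ 2 / 4

lemma sweepScale_pos : 0 < sweepScale y r := by
  unfold sweepScale; positivity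

lemma half_width_eq : (1 - r ^ 2) / 2 = 2 * sweepRatio y r * sweepScale y r := by
  have h1 := Real.sq_sqrt (by positivity : 0 ≤ 1 + y ^ 2)
  have h2 := Real.sq_sqrt (by positivity : 0 ≤ r ^ 2 + y ^ 2)
  have h3 : √(1 + y ^ 2) + √(r ^ 2 + y ^ 2) ≠ 0 := by positivity
  rw [sweepRatio, sweepScale]
  field_simp
  linear_combination 4 * h2 - 4 * h1

lemma affine_add_sq_eq (w : ℝ) : (1 + r ^ 2) / 2 + (1 - r ^ 2) / 2 * w + y ^ 2
    = sweepScale y r * (1 + 2 * sweepRatio y r * w + sweepRatio y r ^ 2) := by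
  have h1 := Real.sq_sqrt (by positivity : 0 ≤ 1 + y ^ 2)
  have h2 := Real.sq_sqrt (by positivity : 0 ≤ r ^ 2 + y ^ 2)
  have h3 : √(1 + y ^ 2) + √(r ^ 2 + y ^ 2) ≠ 0 := by positivity
  have h4 : sweepScale y r * (1 + sweepRatio y r ^ 2) = (1 + r ^ 2) / 2 + y ^ 2 := by
    rw [sweepRatio, sweepScale]
    field_simp
    linear_combination 4 * h1 + 4 * h2
  linear_combination w * half_width_eq (y := y) (r := r) - h4

lemma one_sub_sweepRatio_sq :
    sweepScale y r * (1 - sweepRatio y r ^ 2) = √(1 + y ^ 2) * √(r ^ 2 + y ^ 2) := by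
  have h3 : √(1 + y ^ 2) + √(r ^ 2 + y ^ 2) ≠ 0 := by positivity
  rw [sweepRatio, sweepScale]
  field_simp
  ring

lemma one_add_sweepRatio : 1 + sweepRatio y r
    = 2 / (√(1 + y ^ 2) + √(r ^ 2 + y ^ 2)) * √(1 + y ^ 2) := by
  have h3 : √(1 + y ^ 2) + √(r ^ 2 + y ^ 2) ≠ 0 := by positivity
  rw [sweepRatio]; field_simp; ring

lemma one_sub_sweepRatio : 1 - sweepRatio y r
    = 2 / (√(1 + y ^ 2) + √(r ^ 2 + y ^ 2)) * √(r ^ 2 + y ^ 2) := by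
  have h3 : √(1 + y ^ 2) + √(r ^ 2 + y ^ 2) ≠ 0 := by positivity
  rw [sweepRatio]; field_simp; ring

lemma sweepRatio_condition_le {γ : ℝ} (h : γ * √(1 + y ^ 2) ≤ (1 + γ) * √(r ^ 2 + y ^ 2)) :
    γ * (1 + sweepRatio y r) ≤ (1 + γ) * (1 - sweepRatio y r) := by
  rw [one_add_sweepRatio, one_sub_sweepRatio, mul_left_comm, mul_left_comm (1 + γ)]
  gcongr

lemma sweepRatio_condition_eq {γ : ℝ} (h : γ * √(1 + y ^ 2) = (1 + γ) * √(r ^ 2 + y ^ 2)) :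
    γ * (1 + sweepRatio y r) = (1 + γ) * (1 - sweepRatio y r) := by
  rw [one_add_sweepRatio, one_sub_sweepRatio, mul_left_comm, mul_left_comm (1 + γ), h]

lemma sq_radiusOfAngle (hr0 : 0 ≤ r) (hr1 : r < 1) (φ : ℝ) :
    radiusOfAngle r φ ^ 2 = (1 + r ^ 2) / 2 + (1 - r ^ 2) / 2 * Real.cos φ :=
  Real.sq_sqrt <| by
    have h : 0 ≤ (1 - r ^ 2) / 2 := by nlinarith
    nlinarith [mul_le_mul_of_nonneg_left (Real.neg_one_le_cos φ) h, sq_nonneg r]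

@[fun_prop]
lemma continuous_radiusOfAngle : Continuous (radiusOfAngle r) := by
  unfold radiusOfAngle; fun_prop

lemma cos_mem_Ioo {φ : ℝ} (hφ : φ ∈ Ioo 0 Real.pi) : Real.cos φ ∈ Ioo (-1 : ℝ) 1 := by
  have h1 := Real.sin_pos_of_mem_Ioo hφ
  have h2 := Real.sin_sq_add_cos_sq φ
  constructor <;> nlinarith

lemma radiusOfAngle_mem (hr0 : 0 ≤ r) (hr1 : r < 1) {φ : ℝ} (hφ : φ ∈ Ioo 0 Real.pi) :
    radiusOfAngle r φ ∈ Ioo r 1 := by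
  have h := sq_radiusOfAngle hr0 hr1 φ
  have h1 := cos_mem_Ioo hφ
  have h2 : 0 < 1 - r ^ 2 := by nlinarith
  have h3 : 0 ≤ radiusOfAngle r φ := Real.sqrt_nonneg _
  constructor
  · refine lt_of_pow_lt_pow_left₀ 2 h3 ?_
    nlinarith [h1.1]
  · refine lt_of_pow_lt_pow_left₀ 2 zero_le_one ?_
    nlinarith [h1.2]

lemma hasDerivAt_radiusOfAngle (hr0 : 0 ≤ r) (hr1 : r < 1) {φ : ℝ} (hφ : φ ∈ Ioo 0 Real.pi) :
    HasDerivAt (radiusOfAngle r)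
      (-((1 - r ^ 2) / 2 * Real.sin φ) / (2 * radiusOfAngle r φ)) φ := by
  have h1 := (radiusOfAngle_mem hr0 hr1 hφ).1
  have h2 := sq_radiusOfAngle hr0 hr1 φ
  have h : HasDerivAt (fun φ => (1 + r ^ 2) / 2 + (1 - r ^ 2) / 2 * Real.cos φ)
      (-((1 - r ^ 2) / 2 * Real.sin φ)) φ := by
    simpa using ((Real.hasDerivAt_cos φ).const_mul ((1 - r ^ 2) / 2)).const_add ((1 + r ^ 2) / 2)
  exact h.sqrt (by rw [← h2]; exact (pow_pos (hr0.trans_lt h1) 2).ne')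

lemma injOn_radiusOfAngle (hr0 : 0 ≤ r) (hr1 : r < 1) :
    InjOn (radiusOfAngle r) (Ioo 0 Real.pi) := fun φ hφ ψ hψ h => by
  have h1 := sq_radiusOfAngle hr0 hr1 φ
  rw [h, sq_radiusOfAngle hr0 hr1 ψ] at h1
  have h2 : (1 - r ^ 2) / 2 ≠ 0 := by nlinarith
  refine Real.injOn_cos (Ioo_subset_Icc_self hφ) (Ioo_subset_Icc_self hψ) ?_
  exact (mul_left_cancel₀ h2 (add_left_cancel h1)).symm

lemma image_radiusOfAngle (hr0 : 0 ≤ r) (hr1 : r < 1) :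
    radiusOfAngle r '' Ioo 0 Real.pi = Ioo r 1 := by
  refine Subset.antisymm (by rintro _ ⟨φ, hφ, rfl⟩; exact radiusOfAngle_mem hr0 hr1 hφ) ?_
  intro x hx
  have hb : 0 < 1 - r ^ 2 := by nlinarith
  have hx0 : 0 < x := hr0.trans_lt hx.1
  have hw1 : -1 < (2 * x ^ 2 - (1 + r ^ 2)) / (1 - r ^ 2) := by
    rw [lt_div_iff₀ hb]; nlinarith [hx.1]
  have hw2 : (2 * x ^ 2 - (1 + r ^ 2)) / (1 - r ^ 2) < 1 := by
    rw [div_lt_iff₀ hb]; nlinarith [hx.2]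
  refine ⟨Real.arccos ((2 * x ^ 2 - (1 + r ^ 2)) / (1 - r ^ 2)),
    ⟨Real.arccos_pos.2 hw2, ?_⟩, ?_⟩
  · refine lt_of_le_of_ne (Real.arccos_le_pi _) fun h => ?_
    exact hw1.not_ge (Real.arccos_eq_pi.1 h)
  · rw [radiusOfAngle, Real.cos_arccos hw1.le hw2.le]
    rw [show (1 + r ^ 2) / 2 + (1 - r ^ 2) / 2 * ((2 * x ^ 2 - (1 + r ^ 2)) / (1 - r ^ 2)) = x ^ 2 by
      field_simp; ring]
    exact Real.sqrt_sq hx0.le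

lemma shellDensity_neg (γ y r x : ℝ) : shellDensity γ y r (-x) = shellDensity γ y r x := by
  simp only [shellDensity, neg_sq, abs_neg]

lemma measurable_shellDensity (γ y r : ℝ) : Measurable (shellDensity γ y r) := by
  unfold shellDensity; fun_prop

lemma angleDensity_eq (hr0 : 0 ≤ r) (hr1 : r < 1) (γ φ : ℝ) :
    angleDensity γ (sweepRatio y r) φ = Real.pi⁻¹ * (1 + γ - γ * (√(1 + y ^ 2) * √(r ^ 2 + y ^ 2) /
      (radiusOfAngle r φ ^ 2 + y ^ 2))) := by
  rw [angleDensity, sq_radiusOfAngle hr0 hr1, affine_add_sq_eq, ← one_sub_sweepRatio_sq,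
    mul_div_mul_left _ _ sweepScale_pos.ne']

/-- Each of the two branches `± radiusOfAngle r` carries half of the angular density. -/
lemma abs_deriv_mul_shellDensity (hr0 : 0 ≤ r) (hr1 : r < 1) (γ : ℝ) {φ : ℝ}
    (hφ : φ ∈ Ioo 0 Real.pi) :
    |-((1 - r ^ 2) / 2 * Real.sin φ) / (2 * radiusOfAngle r φ)| *
      shellDensity γ y r (radiusOfAngle r φ) = angleDensity γ (sweepRatio y r) φ / 2 := by
  have hs := Real.sin_pos_of_mem_Ioo hφ
  have hb : 0 < (1 - r ^ 2) / 2 := by nlinarith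
  have ht : 0 < radiusOfAngle r φ := hr0.trans_lt (radiusOfAngle_mem hr0 hr1 hφ).1
  have e : (radiusOfAngle r φ ^ 2 - r ^ 2) * (1 - radiusOfAngle r φ ^ 2)
      = ((1 - r ^ 2) / 2 * Real.sin φ) ^ 2 := by
    rw [sq_radiusOfAngle hr0 hr1]
    linear_combination (-((1 - r ^ 2) / 2) ^ 2) * Real.sin_sq_add_cos_sq φ
  rw [angleDensity_eq hr0 hr1, shellDensity, e, Real.sqrt_sq (by positivity), neg_div, abs_neg,
    abs_of_pos (by positivity), abs_of_pos ht]
  have hb' : 1 - r ^ 2 ≠ 0 := by linarith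
  field_simp

lemma setOf_shell_eq (hr0 : 0 ≤ r) :
    {x : ℝ | r < |x| ∧ |x| < 1} = Ioo r 1 ∪ (Neg.neg ⁻¹' Ioo r 1) := by
  ext x
  simp only [mem_ofPred_eq, mem_union, mem_preimage, mem_Ioo]
  rcases le_total 0 x with h | h
  · rw [abs_of_nonneg h]
    constructor
    · exact Or.inl
    · rintro (h' | h')
      · exact h'
      · exact absurd h'.1 (by linarith)
  · rw [abs_of_nonpos h]
    constructor
    · exact Or.inr
    · rintro (h' | h')
      · exact absurd h'.1 (by linarith)
      · exact h'

/-- The substitution `x = ± radiusOfAngle r φ`. -/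
lemma lintegral_shellMeasure (hr0 : 0 ≤ r) (hr1 : r < 1) (γ : ℝ)
    (hry : 0 < r ^ 2 + y ^ 2) {f : ℝ → ENNReal} (hf : Measurable f) :
    ∫⁻ x, f x ∂shellMeasure γ y r = ∫⁻ φ, 2⁻¹ * (f (radiusOfAngle r φ) + f (-radiusOfAngle r φ))
      ∂angleMeasure γ (sweepRatio y r) := by
  have key : ∀ g : ℝ → ENNReal, ∫⁻ x in Ioo r 1, ENNReal.ofReal (shellDensity γ y r x) * g x
      = ∫⁻ φ in Ioo 0 Real.pi, ENNReal.ofReal (angleDensity γ (sweepRatio y r) φ) *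
        (2⁻¹ * g (radiusOfAngle r φ)) := fun g => by
    rw [← image_radiusOfAngle hr0 hr1, lintegral_image_eq_lintegral_abs_deriv_mul measurableSet_Ioo
      (fun φ hφ => (hasDerivAt_radiusOfAngle hr0 hr1 hφ).hasDerivWithinAt)
      (injOn_radiusOfAngle hr0 hr1)]
    refine setLIntegral_congr_fun measurableSet_Ioo fun φ hφ => ?_
    rw [← mul_assoc, ← mul_assoc, ← ENNReal.ofReal_mul (abs_nonneg _),
      abs_deriv_mul_shellDensity hr0 hr1 γ hφ, ENNReal.ofReal_div_of_pos two_pos,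
      ENNReal.ofReal_ofNat, ENNReal.div_eq_inv_mul, mul_comm (2⁻¹ : ENNReal)]
  have hcont := continuous_angleDensity (γ := γ) (sweepRatio_pos (y := y) hr0 hr1).le
    (sweepRatio_lt_one hry)
  have hdisj : Disjoint (Ioo r 1) (Neg.neg ⁻¹' Ioo r 1) := by
    rw [Set.disjoint_left]
    intro x hx hx'
    have := hx'.1
    linarith [hx.1]
  have hneg : ∫⁻ x in Neg.neg ⁻¹' Ioo r 1, ENNReal.ofReal (shellDensity γ y r x) * f x
      = ∫⁻ x in Ioo r 1, ENNReal.ofReal (shellDensity γ y r x) * f (-x) := by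
    have h := (Measure.measurePreserving_neg (volume : Measure ℝ)).setLIntegral_comp_preimage
      (measurableSet_Ioo (a := r) (b := 1))
      (f := fun x => ENNReal.ofReal (shellDensity γ y r x) * f (-x))
      ((measurable_shellDensity γ y r).ennreal_ofReal.mul (hf.comp measurable_neg))
    simpa only [shellDensity_neg, neg_neg] using h
  rw [shellMeasure, lintegral_withDensity_eq_lintegral_mul _
    (measurable_shellDensity γ y r).ennreal_ofReal hf, setOf_shell_eq hr0]
  simp only [Pi.mul_apply]
  rw [lintegral_union (measurable_neg measurableSet_Ioo) hdisj, hneg, key, key fun x => f (-x),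
    angleMeasure, lintegral_withDensity_eq_lintegral_mul _ hcont.measurable.ennreal_ofReal
    (by fun_prop), ← lintegral_add_left]
  · simp only [Pi.mul_apply, mul_add]
  · exact hcont.measurable.ennreal_ofReal.mul (by fun_prop)

lemma shellMeasure_eq (hr0 : 0 ≤ r) (hr1 : r < 1) (γ : ℝ) (hry : 0 < r ^ 2 + y ^ 2) :
    shellMeasure γ y r = (2⁻¹ : ENNReal) •
      ((angleMeasure γ (sweepRatio y r)).map (radiusOfAngle r) +
        (angleMeasure γ (sweepRatio y r)).map fun φ => -radiusOfAngle r φ) := by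
  refine Measure.ext_of_lintegral _ fun f hf => ?_
  rw [lintegral_shellMeasure hr0 hr1 γ hry hf, lintegral_smul_measure, lintegral_add_measure,
    lintegral_map hf (by fun_prop), lintegral_map hf (by fun_prop),
    lintegral_const_mul _ (by fun_prop), lintegral_add_left (by fun_prop), smul_eq_mul]

end Sweep

end LogEquilibrium

/-! ### Frostman's conditions -/

namespace LogEquilibrium
open Filter Topology

/-- The relation between the charge `γ` at height `y` and the inner radius `r` of the support: the
density is nonnegative, and a genuine gap (`r ≠ 0`) occurs only when the density vanishes at its
edge. -/
structure IsEquilibriumRadius (γ y r : ℝ) : Prop where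
  charge_pos : 0 < γ
  nonneg : 0 ≤ r
  lt_one : r < 1
  pos : 0 < r ^ 2 + y ^ 2
  le : γ * √(1 + y ^ 2) ≤ (1 + γ) * √(r ^ 2 + y ^ 2)
  eq_of_ne_zero : r ≠ 0 → γ * √(1 + y ^ 2) = (1 + γ) * √(r ^ 2 + y ^ 2)

namespace IsEquilibriumRadius

variable {γ y r : ℝ}

lemma ratio_nonneg (h : IsEquilibriumRadius γ y r) : 0 ≤ sweepRatio y r :=
  (sweepRatio_pos h.nonneg h.lt_one).le

lemma ratio_lt_one (h : IsEquilibriumRadius γ y r) : sweepRatio y r < 1 :=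
  sweepRatio_lt_one h.pos

lemma density_nonneg (h : IsEquilibriumRadius γ y r) (φ : ℝ) :
    0 ≤ angleDensity γ (sweepRatio y r) φ :=
  angleDensity_nonneg h.charge_pos.le h.ratio_nonneg h.ratio_lt_one (sweepRatio_condition_le h.le) φ

lemma half_width_pos (h : IsEquilibriumRadius γ y r) : 0 < (1 - r ^ 2) / 2 := by
  nlinarith [h.nonneg, h.lt_one]

lemma isProbabilityMeasure_angle (h : IsEquilibriumRadius γ y r) :
    IsProbabilityMeasure (angleMeasure γ (sweepRatio y r)) :=
  isProbabilityMeasure_angleMeasure h.ratio_nonneg h.ratio_lt_one h.density_nonneg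

lemma isProbabilityMeasure (h : IsEquilibriumRadius γ y r) :
    IsProbabilityMeasure (shellMeasure γ y r) := by
  have := h.isProbabilityMeasure_angle
  refine ⟨?_⟩
  rw [← lintegral_one, lintegral_shellMeasure h.nonneg h.lt_one γ h.pos measurable_const]
  simp [one_add_one_eq_two, ENNReal.inv_mul_cancel]

end IsEquilibriumRadius

lemma measurable_logKernel_right (x : ℝ) : Measurable fun t => logKernel x t :=
  measurable_logKernel.comp measurable_prodMk_left

lemma measurableSet_shell (r : ℝ) : MeasurableSet {x : ℝ | r < |x| ∧ |x| < 1} :=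
  (measurableSet_lt measurable_const measurable_id.abs).inter
    (measurableSet_lt measurable_id.abs measurable_const)

lemma ae_shellMeasure_mem (γ y r : ℝ) : ∀ᵐ x ∂shellMeasure γ y r, r < |x| ∧ |x| < 1 :=
  (withDensity_absolutelyContinuous _ _).ae_le (ae_restrict_mem (measurableSet_shell r))

lemma ae_shellMeasure_mem_Icc (γ y r : ℝ) : ∀ᵐ x ∂shellMeasure γ y r, x ∈ Icc (-1 : ℝ) 1 :=
  (ae_shellMeasure_mem γ y r).mono fun _ hx => abs_le.1 hx.2.le

lemma ae_shellMeasure_ne (γ y r x : ℝ) : ∀ᵐ t ∂shellMeasure γ y r, x ≠ t := by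
  have : ∀ᵐ t : ℝ, x ≠ t := by simp [ae_iff]
  exact (withDensity_absolutelyContinuous _ _).ae_le (ae_restrict_of_ae this)

/-- The coordinate of `x²` under the affine map of `[r², 1]` onto `[-1, 1]`. -/
noncomputable def shellCoord (r x : ℝ) : ℝ := (x ^ 2 - (1 + r ^ 2) / 2) / ((1 - r ^ 2) / 2)

namespace IsEquilibriumRadius

variable {γ y r : ℝ}

/-- The kernels at `t` and `-t` combine, as `|x - t| |x + t| = |x² - t²|`, to the kernel in the
variable `x²`. -/
lemma logKernel_add_logKernel_neg (h : IsEquilibriumRadius γ y r) {x φ : ℝ}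
    (hφ : shellCoord r x ≠ Real.cos φ) :
    logKernel x (radiusOfAngle r φ) + logKernel x (-radiusOfAngle r φ)
      = -Real.log ((1 - r ^ 2) / 2) + logKernel (shellCoord r x) (Real.cos φ) := by
  have hb := h.half_width_pos
  have e : (x - radiusOfAngle r φ) * (x - -radiusOfAngle r φ)
      = (1 - r ^ 2) / 2 * (shellCoord r x - Real.cos φ) := by
    have h1 := sq_radiusOfAngle h.nonneg h.lt_one φ
    have h2 : (1 - r ^ 2) / 2 * shellCoord r x = x ^ 2 - (1 + r ^ 2) / 2 := by
      rw [shellCoord, mul_div_cancel₀ _ hb.ne']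
    rw [mul_sub ((1 - r ^ 2) / 2), h2]
    linear_combination -h1
  have hne : (1 - r ^ 2) / 2 * (shellCoord r x - Real.cos φ) ≠ 0 :=
    mul_ne_zero hb.ne' (sub_ne_zero.2 hφ)
  have hne' := hne
  rw [← e] at hne'
  simp only [logKernel, Real.log_abs]
  rw [← neg_add, ← neg_add, ← Real.log_mul (left_ne_zero_of_mul hne') (right_ne_zero_of_mul hne'),
    e, Real.log_mul hb.ne' (sub_ne_zero.2 hφ)]

lemma radiusOfAngle_mem_Icc (h : IsEquilibriumRadius γ y r) {φ : ℝ} (hφ : φ ∈ Ioo 0 Real.pi) :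
    radiusOfAngle r φ ∈ Icc (-1 : ℝ) 1 ∧ -radiusOfAngle r φ ∈ Icc (-1 : ℝ) 1 := by
  have h1 := radiusOfAngle_mem h.nonneg h.lt_one hφ
  have h2 := h.nonneg
  refine ⟨⟨?_, h1.2.le⟩, ⟨?_, ?_⟩⟩ <;> linarith [h1.1, h1.2]

lemma integrable_branches (h : IsEquilibriumRadius γ y r) {x : ℝ} (hx : x ∈ Icc (-1 : ℝ) 1) :
    Integrable (fun φ => logKernel x (radiusOfAngle r φ)) (angleMeasure γ (sweepRatio y r)) ∧
    Integrable (fun φ => logKernel x (-radiusOfAngle r φ)) (angleMeasure γ (sweepRatio y r)) := by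
  have := h.isProbabilityMeasure_angle
  have hs := (integrable_const (μ := angleMeasure γ (sweepRatio y r))
    (-Real.log ((1 - r ^ 2) / 2))).add (integrable_logKernel_cos h.ratio_nonneg h.ratio_lt_one
    h.density_nonneg (shellCoord r x))
  -- Only the sum of the two branches is known to be integrable; each is bounded below.
  have key : ∀ σ : ℝ → ℝ, Measurable σ →
      (∀ φ ∈ Ioo 0 Real.pi, shellCoord r x ≠ Real.cos φ →
        |logKernel x (σ φ)| ≤ |logKernel x (radiusOfAngle r φ)
          + logKernel x (-radiusOfAngle r φ)| + Real.log 2) →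
      Integrable (fun φ => logKernel x (σ φ)) (angleMeasure γ (sweepRatio y r)) := by
    intro σ hσ hle
    refine (hs.abs.add (integrable_const (Real.log 2))).mono'
      ((measurable_logKernel_right x).comp hσ).aestronglyMeasurable ?_
    filter_upwards [ae_angleMeasure_mem γ (sweepRatio y r),
      ae_angleMeasure_cos_ne γ (sweepRatio y r) (shellCoord r x)] with φ h1 h2
    simp only [Pi.add_apply, Real.norm_eq_abs, ← h.logKernel_add_logKernel_neg h2]
    exact hle φ h1 h2
  have l2 := Real.log_nonneg one_le_two
  constructor <;> refine key _ (by fun_prop) fun φ hφ _ => ?_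
  all_goals
    have h4 := neg_log_two_le_logKernel hx (h.radiusOfAngle_mem_Icc hφ).1
    have h5 := neg_log_two_le_logKernel hx (h.radiusOfAngle_mem_Icc hφ).2
    have h6 := le_abs_self (logKernel x (radiusOfAngle r φ) + logKernel x (-radiusOfAngle r φ))
    have h7 := abs_nonneg (logKernel x (radiusOfAngle r φ) + logKernel x (-radiusOfAngle r φ))
    rw [abs_le]
    constructor <;> linarith

lemma integrable_logKernel (h : IsEquilibriumRadius γ y r) {x : ℝ} (hx : x ∈ Icc (-1 : ℝ) 1) :
    Integrable (fun t => logKernel x t) (shellMeasure γ y r) := by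
  have hm := fun μ : Measure ℝ => (measurable_logKernel_right x).aestronglyMeasurable (μ := μ)
  rw [shellMeasure_eq h.nonneg h.lt_one γ h.pos]
  refine Integrable.smul_measure (Integrable.add_measure ?_ ?_) (by simp)
  · exact (integrable_map_measure (hm _) (by fun_prop)).2 (h.integrable_branches hx).1
  · exact (integrable_map_measure (hm _) (by fun_prop)).2 (h.integrable_branches hx).2

lemma integral_logKernel (h : IsEquilibriumRadius γ y r) {x : ℝ} (hx : x ∈ Icc (-1 : ℝ) 1) :
    ∫ t, logKernel x t ∂shellMeasure γ y r = (-Real.log ((1 - r ^ 2) / 2) +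
      ∫ φ, logKernel (shellCoord r x) (Real.cos φ) ∂angleMeasure γ (sweepRatio y r)) / 2 := by
  have := h.isProbabilityMeasure_angle
  have hm := fun μ : Measure ℝ => (measurable_logKernel_right x).aestronglyMeasurable (μ := μ)
  obtain ⟨i1, i2⟩ := h.integrable_branches hx
  have e : ∫ φ, (logKernel x (radiusOfAngle r φ) + logKernel x (-radiusOfAngle r φ))
      ∂angleMeasure γ (sweepRatio y r) = -Real.log ((1 - r ^ 2) / 2) +
      ∫ φ, logKernel (shellCoord r x) (Real.cos φ) ∂angleMeasure γ (sweepRatio y r) := by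
    rw [integral_congr_ae ((ae_angleMeasure_cos_ne γ (sweepRatio y r) (shellCoord r x)).mono
      fun φ hφ => h.logKernel_add_logKernel_neg hφ), integral_add (integrable_const _)
      (integrable_logKernel_cos h.ratio_nonneg h.ratio_lt_one h.density_nonneg _), integral_const]
    simp
  rw [shellMeasure_eq h.nonneg h.lt_one γ h.pos, integral_smul_measure,
    integral_add_measure ((integrable_map_measure (hm _) (by fun_prop)).2 i1)
    ((integrable_map_measure (hm _) (by fun_prop)).2 i2),
    integral_map (by fun_prop) (hm _), integral_map (by fun_prop) (hm _), ← integral_add i1 i2, e]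
  simp
  ring

/-- The equilibrium constant: the value on the support of the potential plus the field. -/
noncomputable def robinConst (γ y r : ℝ) : ℝ :=
  (Real.log 2 - Real.log ((1 - r ^ 2) / 2) - γ * Real.log (sweepScale y r)) / 2

lemma sq_add_sq_eq (h : IsEquilibriumRadius γ y r) (x : ℝ) : x ^ 2 + y ^ 2
    = sweepScale y r * (1 + 2 * sweepRatio y r * shellCoord r x + sweepRatio y r ^ 2) := by
  rw [← affine_add_sq_eq, shellCoord, mul_div_cancel₀ _ h.half_width_pos.ne']
  ring

lemma shellCoord_le_one (h : IsEquilibriumRadius γ y r) {x : ℝ} (hx : x ∈ Icc (-1 : ℝ) 1) :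
    shellCoord r x ≤ 1 := by
  rw [shellCoord, div_le_one h.half_width_pos]
  nlinarith [hx.1, hx.2]

lemma neg_one_le_shellCoord (h : IsEquilibriumRadius γ y r) {x : ℝ} :
    -1 ≤ shellCoord r x ↔ r ≤ |x| := by
  rw [shellCoord, le_div_iff₀ h.half_width_pos, ← abs_of_nonneg h.nonneg, ← sq_le_sq,
    abs_of_nonneg h.nonneg]
  constructor <;> intro h <;> linarith

lemma potential_bounded (h : IsEquilibriumRadius γ y r) : ∃ M, ∀ x ∈ Icc (-1 : ℝ) 1,
    ∫ t, logKernel x t ∂shellMeasure γ y r ≤ M := by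
  refine ⟨(-Real.log ((1 - r ^ 2) / 2) + (Real.log 2 + γ * Real.log 4)) / 2, fun x hx => ?_⟩
  rw [h.integral_logKernel hx]
  have := integral_logKernel_cos_le h.charge_pos.le h.ratio_nonneg h.ratio_lt_one h.density_nonneg
    (h.shellCoord_le_one hx)
  linarith

/-- The Frostman equality on the support. -/
lemma potential_eq (h : IsEquilibriumRadius γ y r) {x : ℝ} (hx : x ∈ Icc (-1 : ℝ) 1)
    (hrx : r ≤ |x|) : ∫ t, logKernel x t ∂shellMeasure γ y r
      = robinConst γ y r + γ / 2 * Real.log (x ^ 2 + y ^ 2) := by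
  have hw := h.neg_one_le_shellCoord.2 hrx
  have hp := one_add_two_mul_pos h.ratio_nonneg h.ratio_lt_one hw
  rw [h.integral_logKernel hx, integral_logKernel_cos_of_mem_Icc h.ratio_nonneg h.ratio_lt_one
    h.density_nonneg ⟨hw, h.shellCoord_le_one hx⟩, h.sq_add_sq_eq, robinConst,
    Real.log_mul sweepScale_pos.ne' hp.ne']
  ring

/-- The Frostman inequality on the whole interval, off the charge. -/
lemma le_potential (h : IsEquilibriumRadius γ y r) {x : ℝ} (hx : x ∈ Icc (-1 : ℝ) 1)
    (hxy : 0 < x ^ 2 + y ^ 2) : robinConst γ y r + γ / 2 * Real.log (x ^ 2 + y ^ 2)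
      ≤ ∫ t, logKernel x t ∂shellMeasure γ y r := by
  rcases le_or_gt r |x| with hrx | hrx
  · exact (h.potential_eq hx hrx).ge
  · have hw : shellCoord r x < -1 := not_le.1 fun h' => hrx.not_ge (h.neg_one_le_shellCoord.1 h')
    have hr : r ≠ 0 := ((abs_nonneg x).trans_lt hrx).ne'
    have hp : 0 < 1 + 2 * sweepRatio y r * shellCoord r x + sweepRatio y r ^ 2 := by
      rw [h.sq_add_sq_eq] at hxy
      exact pos_of_mul_pos_right hxy sweepScale_pos.le
    have := le_integral_logKernel_cos h.charge_pos.le h.ratio_nonneg h.ratio_lt_one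
      h.density_nonneg (sweepRatio_condition_eq (h.eq_of_ne_zero hr)) hw hp
    rw [h.integral_logKernel hx, h.sq_add_sq_eq, robinConst,
      Real.log_mul sweepScale_pos.ne' hp.ne']
    linarith

/-- Every probability measure on `[-1, 1]` has finite mutual energy with the shell measure, because
the potential of the latter is bounded. -/
lemma integrable_prod (h : IsEquilibriumRadius γ y r) {μ : Measure ℝ} [IsProbabilityMeasure μ]
    (hμ : ∀ᵐ x ∂μ, x ∈ Icc (-1 : ℝ) 1) :
    Integrable (fun p : ℝ × ℝ => logKernel p.1 p.2) (μ.prod (shellMeasure γ y r)) := by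
  have := h.isProbabilityMeasure
  obtain ⟨M, hM⟩ := h.potential_bounded
  rw [integrable_prod_iff measurable_logKernel.aestronglyMeasurable]
  refine ⟨hμ.mono fun x hx => h.integrable_logKernel hx, ?_⟩
  refine Integrable.of_bound (C := M + 2 * Real.log 2)
    measurable_logKernel.norm.stronglyMeasurable.integral_prod_right'.aestronglyMeasurable ?_
  filter_upwards [hμ] with x hx
  rw [Real.norm_of_nonneg (integral_nonneg fun _ => norm_nonneg _)]
  have l2 := Real.log_nonneg one_le_two
  calc ∫ t, ‖logKernel x t‖ ∂shellMeasure γ y r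
      ≤ ∫ t, (logKernel x t + 2 * Real.log 2) ∂shellMeasure γ y r := by
        refine integral_mono_ae (h.integrable_logKernel hx).norm
          ((h.integrable_logKernel hx).add (integrable_const _)) ?_
        filter_upwards [ae_shellMeasure_mem_Icc γ y r] with t ht
        have := neg_log_two_le_logKernel hx ht
        rw [Real.norm_eq_abs, abs_le]
        constructor <;> linarith
    _ = ∫ t, logKernel x t ∂shellMeasure γ y r + 2 * Real.log 2 := by
        rw [integral_add (h.integrable_logKernel hx) (integrable_const _)]
        simp
    _ ≤ M + 2 * Real.log 2 := by gcongr; exact hM x hx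

lemma ae_prod_ne (h : IsEquilibriumRadius γ y r) (μ : Measure ℝ) [SFinite μ] :
    ∀ᵐ p ∂μ.prod (shellMeasure γ y r), p.1 ≠ p.2 := by
  have := h.isProbabilityMeasure
  refine (Measure.ae_prod_iff_ae_ae
    (measurableSet_eq_fun measurable_fst measurable_snd).compl).2 ?_
  exact Eventually.of_forall fun x => ae_shellMeasure_ne γ y r x

end IsEquilibriumRadius

end LogEquilibrium

/-! ### Extended real energies and minimality -/

namespace LogEquilibrium
open Filter Topology

section ExtIntegral

variable {α : Type*} [MeasurableSpace α] {μ : Measure α}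

lemma extIntegral_eq_integral {f : α → EReal} {g : α → ℝ} (hg : Integrable g μ)
    (hfg : ∀ᵐ a ∂μ, f a = (g a : EReal)) : extIntegral μ f = ((∫ a, g a ∂μ : ℝ) : EReal) := by
  have h1 : ∫⁻ a, (f a).toENNReal ∂μ = ∫⁻ a, ENNReal.ofReal (g a) ∂μ :=
    lintegral_congr_ae (hfg.mono fun a ha => by
      simp only [ha, EReal.real_coe_toENNReal])
  have h2 : ∫⁻ a, (-f a).toENNReal ∂μ = ∫⁻ a, ENNReal.ofReal (-g a) ∂μ :=
    lintegral_congr_ae (hfg.mono fun a ha => by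
      simp only [ha, ← EReal.coe_neg, EReal.real_coe_toENNReal])
  have f1 : ∫⁻ a, ENNReal.ofReal (g a) ∂μ ≠ ⊤ := hg.lintegral_lt_top.ne
  have f2 : ∫⁻ a, ENNReal.ofReal (-g a) ∂μ ≠ ⊤ := hg.neg.lintegral_lt_top.ne
  rw [extIntegral, h1, h2, integral_eq_lintegral_pos_part_sub_lintegral_neg_part hg,
    EReal.coe_sub, EReal.coe_ennreal_toReal f1, EReal.coe_ennreal_toReal f2]

lemma lintegral_neg_ne_top [IsFiniteMeasure μ] {f : α → EReal} {C : ℝ}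
    (hC : ∀ᵐ a ∂μ, ((-C : ℝ) : EReal) ≤ f a) : ∫⁻ a, (-f a).toENNReal ∂μ ≠ ⊤ := by
  refine ne_top_of_le_ne_top (b := ∫⁻ _, ENNReal.ofReal C ∂μ) ?_ (lintegral_mono_ae ?_)
  · rw [lintegral_const]
    exact ENNReal.mul_ne_top ENNReal.ofReal_ne_top (measure_ne_top _ _)
  · filter_upwards [hC] with a ha
    rw [← EReal.real_coe_toENNReal]
    refine EReal.toENNReal_le_toENNReal (EReal.neg_le.1 ?_)
    rwa [EReal.coe_neg] at ha

lemma extIntegral_ne_bot [IsFiniteMeasure μ] {f : α → EReal} {C : ℝ}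
    (hC : ∀ᵐ a ∂μ, ((-C : ℝ) : EReal) ≤ f a) : extIntegral μ f ≠ ⊥ := by
  have h := lintegral_neg_ne_top hC
  rw [extIntegral, ← EReal.coe_ennreal_toReal h, sub_eq_add_neg, ← EReal.coe_neg]
  intro h0
  rcases EReal.add_eq_bot_iff.1 h0 with h1 | h1
  · exact EReal.coe_ennreal_ne_bot _ h1
  · exact EReal.coe_ne_bot _ h1

/-- A function bounded below whose extended integral is not `+∞` is finite almost everywhere and
integrable. -/
lemma integrable_toReal_of_extIntegral_ne_top [IsFiniteMeasure μ] {f : α → EReal}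
    (hf : Measurable f) {C : ℝ} (hC : ∀ᵐ a ∂μ, ((-C : ℝ) : EReal) ≤ f a)
    (h : extIntegral μ f ≠ ⊤) :
    (∀ᵐ a ∂μ, f a ≠ ⊤) ∧ Integrable (fun a => (f a).toReal) μ := by
  have hB := lintegral_neg_ne_top hC
  have hA : ∫⁻ a, (f a).toENNReal ∂μ ≠ ⊤ := fun hA => by
    rw [extIntegral, hA, ← EReal.coe_ennreal_toReal hB, EReal.coe_ennreal_top,
      EReal.top_sub_coe] at h
    exact h rfl
  have hmA : Measurable fun a => (f a).toENNReal := hf.ereal_toENNReal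
  have htop : ∀ᵐ a ∂μ, f a ≠ ⊤ := by
    filter_upwards [ae_lt_top hmA hA] with a ha
    exact EReal.toENNReal_ne_top_iff.1 ha.ne
  refine ⟨htop, hf.ereal_toReal.aestronglyMeasurable, ?_⟩
  rw [HasFiniteIntegral]
  refine lt_of_le_of_lt (lintegral_mono_ae (g := fun a => (f a).toENNReal + (-f a).toENNReal) ?_)
    ((lintegral_add_left hmA _).trans_lt (ENNReal.add_lt_top.2 ⟨hA.lt_top, hB.lt_top⟩))
  filter_upwards [htop, hC] with a h1 h2
  have h3 : f a ≠ ⊥ := fun h0 => EReal.coe_ne_bot _ (le_bot_iff.1 (h0 ▸ h2))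
  lift f a to ℝ using ⟨h1, h3⟩ with x
  rw [EReal.toReal_coe, ← EReal.coe_neg, EReal.real_coe_toENNReal, EReal.real_coe_toENNReal,
    Real.enorm_eq_ofReal_abs]
  rcases le_total 0 x with hx | hx
  · rw [abs_of_nonneg hx]; exact le_self_add
  · rw [abs_of_nonpos hx]; exact le_add_self

end ExtIntegral

lemma logInv_of_pos {ρ : ℝ} (h : 0 < ρ) : logInv ρ = ((-Real.log ρ : ℝ) : EReal) := by
  rw [logInv, ENNReal.log_ofReal_of_pos h, EReal.coe_neg]

lemma logInv_zero : logInv 0 = ⊤ := by simp [logInv]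

lemma logInv_abs_sub {x t : ℝ} (h : x ≠ t) : logInv |x - t| = (logKernel x t : EReal) :=
  logInv_of_pos (abs_pos.2 (sub_ne_zero.2 h))

lemma toReal_logInv_abs_sub (x t : ℝ) : (logInv |x - t|).toReal = logKernel x t := by
  rcases eq_or_ne x t with rfl | h
  · simp [logInv_zero, logKernel]
  · rw [logInv_abs_sub h, EReal.toReal_coe]

lemma measurable_logInv : Measurable logInv :=
  (ENNReal.measurable_log.comp ENNReal.measurable_ofReal).neg

lemma neg_log_two_le_logInv {x t : ℝ} (hx : x ∈ Icc (-1 : ℝ) 1) (ht : t ∈ Icc (-1 : ℝ) 1) :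
    ((-Real.log 2 : ℝ) : EReal) ≤ logInv |x - t| := by
  rcases eq_or_ne x t with rfl | h
  · simp [logInv_zero]
  · rw [logInv_abs_sub h]
    exact EReal.coe_le_coe_iff.2 (neg_log_two_le_logKernel hx ht)

/-- The field `γ log (1 / √(x² + y²))` as a real number, with the value `0` where it is infinite. -/
noncomputable def chargePotential (γ y x : ℝ) : ℝ := -(γ / 2 * Real.log (x ^ 2 + y ^ 2))

lemma measurable_chargePotential (γ y : ℝ) : Measurable (chargePotential γ y) := by
  unfold chargePotential; fun_prop

lemma chargeField_of_pos {γ y x : ℝ} (h : 0 < x ^ 2 + y ^ 2) :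
    chargeField γ y x = (chargePotential γ y x : EReal) := by
  rw [chargeField, logInv_of_pos (Real.sqrt_pos.2 h), ← EReal.coe_mul, Real.log_sqrt h.le,
    chargePotential]
  congr 1
  ring

lemma chargeField_of_eq_zero {γ y x : ℝ} (hγ : 0 < γ) (h : x ^ 2 + y ^ 2 = 0) :
    chargeField γ y x = ⊤ := by
  rw [chargeField, h, Real.sqrt_zero, logInv_zero, EReal.coe_mul_top_of_pos hγ]

lemma sq_add_sq_eq_zero_or_pos (x y : ℝ) : x ^ 2 + y ^ 2 = 0 ∨ 0 < x ^ 2 + y ^ 2 :=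
  (show 0 ≤ x ^ 2 + y ^ 2 by positivity).eq_or_lt'

lemma toReal_chargeField {γ y : ℝ} (hγ : 0 < γ) (x : ℝ) :
    (chargeField γ y x).toReal = chargePotential γ y x := by
  rcases sq_add_sq_eq_zero_or_pos x y with h | h
  · rw [chargeField_of_eq_zero hγ h, chargePotential, h]; simp
  · rw [chargeField_of_pos h, EReal.toReal_coe]

lemma measurable_chargeField {γ y : ℝ} (hγ : 0 < γ) : Measurable (chargeField γ y) := by
  classical
  have e : chargeField γ y = fun x => if x ^ 2 + y ^ 2 = 0 then (⊤ : EReal)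
      else (chargePotential γ y x : EReal) := by
    ext1 x
    split_ifs with h
    · exact chargeField_of_eq_zero hγ h
    · exact chargeField_of_pos ((sq_add_sq_eq_zero_or_pos x y).resolve_left h)
  rw [e]
  exact Measurable.ite (measurableSet_eq_fun (by fun_prop) measurable_const) measurable_const
    (measurable_chargePotential γ y).coe_real_ereal

lemma neg_le_chargeField {γ y x : ℝ} (hγ : 0 < γ) (hx : x ∈ Icc (-1 : ℝ) 1) :
    ((-(γ / 2 * Real.log (1 + y ^ 2)) : ℝ) : EReal) ≤ chargeField γ y x := by
  rcases sq_add_sq_eq_zero_or_pos x y with h | h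
  · rw [chargeField_of_eq_zero hγ h]; exact le_top
  · rw [chargeField_of_pos h, EReal.coe_le_coe_iff, chargePotential]
    have : x ^ 2 ≤ 1 := by nlinarith [hx.1, hx.2]
    gcongr

lemma two_mul_ne_bot {x : EReal} (h : x ≠ ⊥) : 2 * x ≠ ⊥ := by
  induction x with
  | bot => exact absurd rfl h
  | coe a => exact EReal.coe_ne_bot (2 * a)
  | top => rw [EReal.mul_top_of_pos (by norm_num)]; simp

/-- Finiteness of the weighted energy of `μ`, in terms of real-valued kernels: these take the value
`0` where the extended kernels are infinite, so those places are required to be null. -/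
structure HasFiniteEnergy (γ y : ℝ) (μ : Measure ℝ) : Prop where
  ae_ne : ∀ᵐ p ∂μ.prod μ, p.1 ≠ p.2
  integrable_kernel : Integrable (fun p : ℝ × ℝ => logKernel p.1 p.2) (μ.prod μ)
  ae_pos : ∀ᵐ x ∂μ, 0 < x ^ 2 + y ^ 2
  integrable_field : Integrable (chargePotential γ y) μ

/-- The weighted energy computed with the real-valued kernels; it is meaningful under
`HasFiniteEnergy`. -/
noncomputable def realEnergy (γ y : ℝ) (μ : Measure ℝ) : ℝ :=
  (∫ p, logKernel p.1 p.2 ∂μ.prod μ) + 2 * ∫ x, chargePotential γ y x ∂μ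

lemma HasFiniteEnergy.weightedEnergy_eq {γ y : ℝ} {μ : Measure ℝ} (h : HasFiniteEnergy γ y μ) :
    weightedEnergy (chargeField γ y) μ = (realEnergy γ y μ : EReal) := by
  rw [weightedEnergy, logEnergy, extIntegral_eq_integral h.integrable_kernel
    (h.ae_ne.mono fun p hp => logInv_abs_sub hp), extIntegral_eq_integral h.integrable_field
    (h.ae_pos.mono fun x hx => chargeField_of_pos hx), realEnergy, EReal.coe_add, EReal.coe_mul]
  rfl

lemma hasFiniteEnergy_of_weightedEnergy_ne_top {γ y : ℝ} (hγ : 0 < γ) {μ : Measure ℝ}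
    [IsProbabilityMeasure μ] (hμ : ∀ᵐ x ∂μ, x ∈ Icc (-1 : ℝ) 1)
    (h : weightedEnergy (chargeField γ y) μ ≠ ⊤) : HasFiniteEnergy γ y μ := by
  have b1 : ∀ᵐ p ∂μ.prod μ, ((-Real.log 2 : ℝ) : EReal) ≤ logInv |p.1 - p.2| :=
    (ae_prod_mem hμ hμ).mono fun p hp => neg_log_two_le_logInv hp.1 hp.2
  have b2 : ∀ᵐ x ∂μ, ((-(γ / 2 * Real.log (1 + y ^ 2)) : ℝ) : EReal) ≤ chargeField γ y x :=
    hμ.mono fun x hx => neg_le_chargeField hγ hx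
  have n1 : extIntegral (μ.prod μ) (fun p : ℝ × ℝ => logInv |p.1 - p.2|) ≠ ⊤ := fun h0 => by
    rw [weightedEnergy, logEnergy, h0,
      EReal.top_add_of_ne_bot (two_mul_ne_bot (extIntegral_ne_bot b2))] at h
    exact h rfl
  have n2 : extIntegral μ (chargeField γ y) ≠ ⊤ := fun h0 => by
    rw [weightedEnergy, logEnergy, h0, EReal.mul_top_of_pos (by norm_num),
      EReal.add_top_of_ne_bot (extIntegral_ne_bot b1)] at h
    exact h rfl
  have m1 : Measurable fun p : ℝ × ℝ => logInv |p.1 - p.2| :=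
    measurable_logInv.comp (by fun_prop)
  obtain ⟨a1, i1⟩ := integrable_toReal_of_extIntegral_ne_top m1 b1 n1
  obtain ⟨a2, i2⟩ := integrable_toReal_of_extIntegral_ne_top (measurable_chargeField hγ) b2 n2
  refine ⟨a1.mono fun p hp h0 => ?_, ?_, a2.mono fun x hx => ?_, ?_⟩
  · rw [h0, sub_self, abs_zero, logInv_zero] at hp
    exact hp rfl
  · simpa only [toReal_logInv_abs_sub] using i1
  · refine (sq_add_sq_eq_zero_or_pos x y).resolve_left fun h0 => ?_
    exact hx (chargeField_of_eq_zero hγ h0)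
  · simpa only [toReal_chargeField hγ] using i2

namespace IsEquilibriumRadius

variable {γ y r : ℝ}

lemma ae_potential_eq (h : IsEquilibriumRadius γ y r) : ∀ᵐ x ∂shellMeasure γ y r,
    ∫ t, logKernel x t ∂shellMeasure γ y r = robinConst γ y r - chargePotential γ y x := by
  filter_upwards [ae_shellMeasure_mem γ y r] with x hx
  rw [h.potential_eq (abs_le.1 hx.2.le) hx.1.le, chargePotential, sub_neg_eq_add]

lemma hasFiniteEnergy (h : IsEquilibriumRadius γ y r) :
    HasFiniteEnergy γ y (shellMeasure γ y r) := by
  have := h.isProbabilityMeasure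
  have hi := h.integrable_prod (ae_shellMeasure_mem_Icc γ y r)
  refine ⟨h.ae_prod_ne _, hi, ?_, ?_⟩
  · filter_upwards [ae_shellMeasure_mem γ y r] with x hx
    have : 0 < x ^ 2 := by
      rw [← sq_abs]; exact pow_pos (h.nonneg.trans_lt hx.1) 2
    positivity
  · refine ((integrable_const (robinConst γ y r)).sub hi.integral_prod_left).congr ?_
    filter_upwards [h.ae_potential_eq] with x hx
    simp only [Pi.sub_apply, hx, sub_sub_cancel]

/-- The excess energy over the shell measure dominates the squared difference of each Chebyshev
moment: Frostman's conditions make the linear term of the energy nonnegative. -/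
lemma sq_chebMoment_sub_le_realEnergy_sub (h : IsEquilibriumRadius γ y r) {μ : Measure ℝ}
    [IsProbabilityMeasure μ] (hμ : ∀ᵐ x ∂μ, x ∈ Icc (-1 : ℝ) 1) (hE : HasFiniteEnergy γ y μ)
    (n : ℕ) : 2 / n * (chebMoment μ n - chebMoment (shellMeasure γ y r) n) ^ 2
      ≤ realEnergy γ y μ - realEnergy γ y (shellMeasure γ y r) := by
  have := h.isProbabilityMeasure
  have hω := h.hasFiniteEnergy
  have hi := h.integrable_prod hμ
  have key := sq_chebMoment_sub_le hμ (ae_shellMeasure_mem_Icc γ y r) hE.ae_ne (h.ae_prod_ne μ)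
    hω.ae_ne hE.integrable_kernel hi hω.integrable_kernel n
  have e1 : robinConst γ y r - ∫ x, chargePotential γ y x ∂μ
      ≤ ∫ p, logKernel p.1 p.2 ∂μ.prod (shellMeasure γ y r) := by
    have e : ∫ x, (robinConst γ y r - chargePotential γ y x) ∂μ
        = robinConst γ y r - ∫ x, chargePotential γ y x ∂μ := by
      rw [integral_sub (integrable_const _) hE.integrable_field]; simp
    rw [integral_prod _ hi, ← e]
    refine integral_mono_ae ((integrable_const _).sub hE.integrable_field)
      hi.integral_prod_left ?_
    filter_upwards [hμ, hE.ae_pos] with x hx hp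
    have := h.le_potential hx hp
    rwa [chargePotential, sub_neg_eq_add]
  have e2 : ∫ p, logKernel p.1 p.2 ∂(shellMeasure γ y r).prod (shellMeasure γ y r)
      = robinConst γ y r - ∫ x, chargePotential γ y x ∂shellMeasure γ y r := by
    rw [integral_prod _ hω.integrable_kernel, integral_congr_ae h.ae_potential_eq,
      integral_sub (integrable_const _) hω.integrable_field]
    simp
  rw [realEnergy, realEnergy]
  linarith

lemma carried (γ y r : ℝ) : shellMeasure γ y r (Icc (-1 : ℝ) 1)ᶜ = 0 :=
  ae_iff.1 (ae_shellMeasure_mem_Icc γ y r)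

theorem isEquilibriumMeasure (h : IsEquilibriumRadius γ y r) :
    IsEquilibriumMeasure (Icc (-1) 1) (chargeField γ y) (shellMeasure γ y r) := by
  refine ⟨h.isProbabilityMeasure, carried γ y r, fun μ hP hμ => ?_⟩
  have hμ' : ∀ᵐ x ∂μ, x ∈ Icc (-1 : ℝ) 1 := ae_iff.2 hμ
  by_cases ht : weightedEnergy (chargeField γ y) μ = ⊤
  · rw [ht]; exact le_top
  · have hE := hasFiniteEnergy_of_weightedEnergy_ne_top h.charge_pos hμ' ht
    rw [hE.weightedEnergy_eq, h.hasFiniteEnergy.weightedEnergy_eq, EReal.coe_le_coe_iff]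
    -- At order `0` the left-hand side is `2 / 0 * _ = 0`.
    have := h.sq_chebMoment_sub_le_realEnergy_sub hμ' hE 0
    simp only [Nat.cast_zero, div_zero, zero_mul] at this
    linarith

theorem eq_shellMeasure (h : IsEquilibriumRadius γ y r) {μ : Measure ℝ}
    (hμ : IsEquilibriumMeasure (Icc (-1) 1) (chargeField γ y) μ) : μ = shellMeasure γ y r := by
  have := h.isProbabilityMeasure
  have := hμ.isProbabilityMeasure
  have hm : ∀ᵐ x ∂μ, x ∈ Icc (-1 : ℝ) 1 := ae_iff.2 hμ.carried
  have hle := hμ.minimal (shellMeasure γ y r) h.isProbabilityMeasure (carried γ y r)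
  rw [h.hasFiniteEnergy.weightedEnergy_eq] at hle
  have hE := hasFiniteEnergy_of_weightedEnergy_ne_top h.charge_pos hm
    (ne_top_of_le_ne_top (EReal.coe_ne_top _) hle)
  rw [hE.weightedEnergy_eq, EReal.coe_le_coe_iff] at hle
  refine eq_of_chebMoment_eq hm (ae_shellMeasure_mem_Icc γ y r) fun n => ?_
  rcases Nat.eq_zero_or_pos n with rfl | hn
  · simp [chebMoment]
  · have h1 := h.sq_chebMoment_sub_le_realEnergy_sub hm hE n
    have h2 : 0 < (2 / n : ℝ) := by positivity
    have h3 : (chebMoment μ n - chebMoment (shellMeasure γ y r) n) ^ 2 ≤ 0 :=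
      nonpos_of_mul_nonpos_right (h1.trans (sub_nonpos.2 hle)) h2
    exact sub_eq_zero.1 (pow_eq_zero_iff two_ne_zero |>.1 (le_antisymm h3 (sq_nonneg _)))

end IsEquilibriumRadius

/-- A density that does not vanish on an open set has the closure of that set as support. -/
lemma support_withDensity_restrict {U : Set ℝ} (hU : IsOpen U) {f : ℝ → ENNReal}
    (hf : Measurable f) (hpos : ∀ x ∈ U, f x ≠ 0) :
    ((volume.restrict U).withDensity f).support = closure U := by
  apply Subset.antisymm
  · refine Measure.support_subset_of_isClosed isClosed_closure ?_
    refine (withDensity_absolutelyContinuous _ _).ae_le ?_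
    exact mem_of_superset (ae_restrict_mem hU.measurableSet) subset_closure
  · intro x hx
    rw [Measure.mem_support_iff_forall]
    intro V hV
    obtain ⟨W, hWV, hW, hxW⟩ := mem_nhds_iff.1 hV
    have hne : (W ∩ U).Nonempty := mem_closure_iff.1 hx W hW hxW
    have hvol : volume.restrict U W ≠ 0 := by
      rw [Measure.restrict_apply hW.measurableSet]
      exact ((hW.inter hU).measure_pos volume hne).ne'
    refine pos_iff_ne_zero.2 fun h0 => hvol ?_
    refine withDensity_absolutelyContinuous' hf.aemeasurable ?_ (measure_mono_null hWV h0)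
    filter_upwards [ae_restrict_mem hU.measurableSet] with z hz using hpos z hz

lemma closure_shell {r : ℝ} (hr0 : 0 ≤ r) (hr1 : r < 1) :
    closure {x : ℝ | r < |x| ∧ |x| < 1} = Icc (-1) (-r) ∪ Icc r 1 := by
  have e : Neg.neg ⁻¹' Ioo r 1 = Ioo (-1) (-r) := by
    ext x
    simp only [mem_preimage, mem_Ioo]
    constructor <;> rintro ⟨h1, h2⟩ <;> constructor <;> linarith
  rw [setOf_shell_eq hr0, e, closure_union, closure_Ioo hr1.ne, closure_Ioo (by linarith),
    union_comm]

lemma IsEquilibriumRadius.support_eq {γ y r : ℝ} (h : IsEquilibriumRadius γ y r) :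
    (shellMeasure γ y r).support = Icc (-1) (-r) ∪ Icc r 1 := by
  have hopen : IsOpen {x : ℝ | r < |x| ∧ |x| < 1} :=
    (isOpen_lt continuous_const continuous_abs).inter (isOpen_lt continuous_abs continuous_const)
  rw [← closure_shell h.nonneg h.lt_one]
  refine support_withDensity_restrict hopen (measurable_shellDensity γ y r).ennreal_ofReal
    fun x hx => ?_
  have hx0 : 0 < |x| := h.nonneg.trans_lt hx.1
  have h1 : r ^ 2 < x ^ 2 := by
    rw [← sq_abs x]; exact pow_lt_pow_left₀ hx.1 h.nonneg two_ne_zero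
  have h2 : x ^ 2 < 1 := by rw [← sq_abs x]; nlinarith [hx.2]
  have hs := Real.sq_sqrt h.pos.le
  have hs0 := Real.sqrt_pos.2 h.pos
  have hγ := h.charge_pos
  have h3 : γ * (√(1 + y ^ 2) * √(r ^ 2 + y ^ 2)) < (1 + γ) * (x ^ 2 + y ^ 2) :=
    calc γ * (√(1 + y ^ 2) * √(r ^ 2 + y ^ 2))
        = γ * √(1 + y ^ 2) * √(r ^ 2 + y ^ 2) := by ring
      _ ≤ (1 + γ) * √(r ^ 2 + y ^ 2) * √(r ^ 2 + y ^ 2) :=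
        mul_le_mul_of_nonneg_right h.le hs0.le
      _ = (1 + γ) * (r ^ 2 + y ^ 2) := by rw [mul_assoc, ← sq, hs]
      _ < _ := by gcongr
  have h4 : 0 < x ^ 2 + y ^ 2 := by linarith [h.pos]
  rw [Ne, ENNReal.ofReal_eq_zero, not_le]
  refine mul_pos (mul_pos (by positivity) ?_) (div_pos hx0 (Real.sqrt_pos.2
    (mul_pos (sub_pos.2 h1) (sub_pos.2 h2))))
  rw [sub_pos, ← mul_div_assoc, div_lt_iff₀ h4]
  exact h3

lemma isEquilibriumRadius_zero {γ y : ℝ} (hγ : 0 < γ) (hy : 0 ≤ y) (h : γ ≤ gammaPlus y) :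
    IsEquilibriumRadius γ y 0 := by
  have hs := Real.sq_sqrt (by positivity : 0 ≤ y ^ 2 + 1)
  have hs0 := Real.sqrt_pos.2 (by positivity : 0 < y ^ 2 + 1)
  have hy0 : 0 < y := by
    rcases hy.eq_or_lt with rfl | hy
    · rw [gammaPlus, zero_mul] at h; linarith
    · exact hy
  refine ⟨hγ, le_rfl, zero_lt_one, by positivity, ?_, fun h0 => absurd rfl h0⟩
  rw [gammaPlus] at h
  rw [show (0 : ℝ) ^ 2 + y ^ 2 = y ^ 2 by ring, Real.sqrt_sq hy, add_comm 1 (y ^ 2)]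
  have h1 : y < √(y ^ 2 + 1) := Real.lt_sqrt_of_sq_lt (by linarith)
  have h2 := mul_le_mul_of_nonneg_right h (sub_pos.2 h1).le
  have h3 : y * (√(y ^ 2 + 1) + y) * (√(y ^ 2 + 1) - y) = y := by linear_combination y * hs
  linarith

lemma innerRadius_sq_add {γ y : ℝ} (hγ : 0 < γ) (hy : 0 ≤ y) (h : gammaPlus y < γ) :
    0 < innerRadius γ y ∧ (innerRadius γ y ^ 2 + y ^ 2) * (1 + γ) ^ 2 = γ ^ 2 * (1 + y ^ 2) := by
  have hs := Real.sq_sqrt (by positivity : 0 ≤ y ^ 2 + 1)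
  have hs0 := Real.sqrt_pos.2 (by positivity : 0 < y ^ 2 + 1)
  rw [gammaPlus] at h
  have hpos : 0 < γ ^ 2 - (2 * γ + 1) * y ^ 2 := by
    have h1 : y * √(y ^ 2 + 1) < γ - y ^ 2 := by linarith
    have h2 := pow_lt_pow_left₀ h1 (by positivity) two_ne_zero
    rw [mul_pow, hs] at h2
    linarith
  refine ⟨div_pos (Real.sqrt_pos.2 hpos) (by linarith), ?_⟩
  have hne : 1 + γ ≠ 0 := by linarith
  rw [innerRadius, div_pow, Real.sq_sqrt hpos.le]
  field_simp
  ring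

lemma isEquilibriumRadius_innerRadius {γ y : ℝ} (hγ : 0 < γ) (hy : 0 ≤ y) (h : gammaPlus y < γ) :
    IsEquilibriumRadius γ y (innerRadius γ y) := by
  obtain ⟨h0, h1⟩ := innerRadius_sq_add hγ hy h
  have e : γ * √(1 + y ^ 2) = (1 + γ) * √(innerRadius γ y ^ 2 + y ^ 2) := by
    rw [← Real.sqrt_sq hγ.le, ← Real.sqrt_mul (by positivity), ← h1,
      Real.sqrt_mul (by positivity), Real.sqrt_sq (by linarith), Real.sqrt_sq hγ.le, mul_comm]
  refine ⟨hγ, h0.le, ?_, by positivity, e.le, fun _ => e⟩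
  refine lt_of_pow_lt_pow_left₀ 2 zero_le_one ?_
  nlinarith [sq_nonneg y]

lemma shellMeasure_zero {γ y : ℝ} (hy : 0 ≤ y) : shellMeasure γ y 0 =
    (volume.restrict (Ioo (-1) 1)).withDensity fun x => ENNReal.ofReal (fullDensity γ y x) := by
  have hset : {x : ℝ | 0 < |x| ∧ |x| < 1} =ᵐ[volume] Ioo (-1) 1 := by
    have : ∀ᵐ x : ℝ, x ≠ 0 := by simp [ae_iff]
    filter_upwards [this] with x hx
    exact propext ⟨fun h => abs_lt.1 h.2, fun h => ⟨abs_pos.2 hx, abs_lt.2 h⟩⟩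
  rw [← Measure.restrict_congr_set hset, shellMeasure]
  refine withDensity_congr_ae ?_
  filter_upwards [ae_restrict_mem (measurableSet_shell 0)] with x hx
  congr 1
  have hx0 : |x| ≠ 0 := hx.1.ne'
  have e : (x ^ 2 - 0 ^ 2) * (1 - x ^ 2) = |x| ^ 2 * (1 - x ^ 2) := by rw [sq_abs]; ring
  rw [shellDensity, fullDensity, e, Real.sqrt_mul (by positivity), Real.sqrt_sq (abs_nonneg x),
    show (0 : ℝ) ^ 2 + y ^ 2 = y ^ 2 by ring, Real.sqrt_sq hy, add_comm 1 (y ^ 2), div_mul_eq_div_div,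
    div_self hx0]
  field_simp

lemma shellMeasure_innerRadius {γ y : ℝ} (hγ : 0 < γ) (hy : 0 ≤ y) (h : gammaPlus y < γ) :
    shellMeasure γ y (innerRadius γ y) =
      (volume.restrict {x : ℝ | innerRadius γ y < |x| ∧ |x| < 1}).withDensity
        fun x => ENNReal.ofReal (gapDensity γ y x) := by
  have hr := isEquilibriumRadius_innerRadius hγ hy h
  obtain ⟨h0, -⟩ := innerRadius_sq_add hγ hy h
  refine withDensity_congr_ae ?_
  filter_upwards [ae_restrict_mem (measurableSet_shell (innerRadius γ y))] with x hx
  congr 1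
  set r := innerRadius γ y with hrdef
  have h1 : r ^ 2 < x ^ 2 := by
    rw [← sq_abs x]; exact pow_lt_pow_left₀ hx.1 h0.le two_ne_zero
  have h2 : x ^ 2 < 1 := by rw [← sq_abs x]; nlinarith [hx.2, abs_nonneg x]
  have h3 : 0 < x ^ 2 + y ^ 2 := by nlinarith [sq_nonneg y, sq_nonneg r]
  have e : γ * (√(1 + y ^ 2) * √(r ^ 2 + y ^ 2)) = (1 + γ) * (r ^ 2 + y ^ 2) := by
    rw [← mul_assoc, hr.eq_of_ne_zero h0.ne', mul_assoc, Real.mul_self_sqrt hr.pos.le]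
  have hs1 := Real.sqrt_pos.2 (sub_pos.2 h1)
  have hs2 := Real.sqrt_pos.2 (sub_pos.2 h2)
  have hs := Real.sq_sqrt (sub_pos.2 h1).le
  rw [shellDensity, gapDensity, ← hrdef, ← mul_div_assoc γ, e, Real.sqrt_mul (sub_pos.2 h1).le]
  field_simp
  rw [hs]
  ring

end LogEquilibrium

theorem mainTheorem7 (γ y₂ : ℝ) (hγ : 0 < γ) (hy₂ : 0 ≤ y₂) :
    ∃ ω : Measure ℝ,
      LogEquilibrium.IsEquilibriumMeasure (Icc (-1) 1) (LogEquilibrium.chargeField γ y₂) ω ∧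
      (∀ ω' : Measure ℝ,
        LogEquilibrium.IsEquilibriumMeasure (Icc (-1) 1) (LogEquilibrium.chargeField γ y₂) ω' →
          ω' = ω) ∧
      (γ ≤ LogEquilibrium.gammaPlus y₂ →
        ω.support = Icc (-1) 1 ∧
        ω = (volume.restrict (Ioo (-1) 1)).withDensity
          (fun x => ENNReal.ofReal (LogEquilibrium.fullDensity γ y₂ x))) ∧
      (LogEquilibrium.gammaPlus y₂ < γ →
        0 < LogEquilibrium.innerRadius γ y₂ ∧ LogEquilibrium.innerRadius γ y₂ < 1 ∧
        ω.support =
          Icc (-1) (-LogEquilibrium.innerRadius γ y₂) ∪ Icc (LogEquilibrium.innerRadius γ y₂) 1 ∧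
        ω = (volume.restrict {x : ℝ | LogEquilibrium.innerRadius γ y₂ < |x| ∧ |x| < 1}).withDensity
          (fun x => ENNReal.ofReal (LogEquilibrium.gapDensity γ y₂ x))) := by
  rcases le_or_gt γ (LogEquilibrium.gammaPlus y₂) with h | h
  · have hr := LogEquilibrium.isEquilibriumRadius_zero hγ hy₂ h
    refine ⟨LogEquilibrium.shellMeasure γ y₂ 0, hr.isEquilibriumMeasure,
      fun ω' => hr.eq_shellMeasure, fun _ => ⟨?_, LogEquilibrium.shellMeasure_zero hy₂⟩,
      fun h' => absurd h h'.not_ge⟩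
    rw [hr.support_eq, neg_zero, Icc_union_Icc_eq_Icc (by norm_num) zero_le_one]
  · have hr := LogEquilibrium.isEquilibriumRadius_innerRadius hγ hy₂ h
    exact ⟨LogEquilibrium.shellMeasure γ y₂ (LogEquilibrium.innerRadius γ y₂),
      hr.isEquilibriumMeasure, fun ω' => hr.eq_shellMeasure, fun h' => absurd h h'.not_gt,
      fun _ => ⟨(LogEquilibrium.innerRadius_sq_add hγ hy₂ h).1, hr.lt_one, hr.support_eq,
        LogEquilibrium.shellMeasure_innerRadius hγ hy₂ h⟩⟩
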